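/- Let $\Omega\subset\mathbb{R}^2$ be a bounded open set, and let $f:\mathbb{R}\to[0,+\infty]$ be convex and lower semicontinuous, with $f(t)\ge\gamma\sqrt{1+t^2}$ for all $t\in\mathbb{R}$ and some $\gamma>0$. Let $f^*(s)=\sup_t\,(st-f(t))$ be the convex conjugate and $f^\infty(t)=\lim_{s\to+\infty}f(st)/s$ the recession function of $f$. Put $\mathbb{S}^1=\mathbb{R}/2\pi\mathbb{Z}$, $\underline\theta=(\cos\theta,\sin\theta)$ and $x^\perp=(x_2,-x_1)$. For $\theta\in\mathbb{S}^1$ and $p=(p^x,p^\theta)\in\mathbb{R}^2\times\mathbb{R}$ let $$h(\theta,p)=\begin{cases}|p^x|\,f(p^\theta/|p^x|)&\text{if }p^x\in\mathbb{R}_+\underline\theta,\ p^x\ne0,\\ f^\infty(p^\theta)&\text{if }p^x=0,\\ +\infty&\text{otherwise.}\end{cases}$$ For $u\in BV(\Omega)$ let $$F(u)=\inf\Big\{\int_{\Omega\times\mathbb{S}^1}h\Big(\theta,\frac{\sigma}{|\sigma|}\Big)\,d|\sigma|\ :\ \operatorname{div}\sigma=0,\ \int_{\mathbb{S}^1}\sigma^x\,d\theta=Du^\perp\Big\},$$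 where $\sigma$ runs over the bounded $\mathbb{R}^3$-valued Radon measures on $\Omega\times\mathbb{S}^1$; the first condition means $\int\nabla\varphi\cdot d\sigma=0$ for all $\varphi\in C_c^1(\Omega\times\mathbb{S}^1)$, the second means $\int\varphi^\perp\cdot d\sigma^x=-\int_\Omega u\,\operatorname{div}\varphi\,dx$ for all $\varphi\in C_c^1(\Omega;\mathbb{R}^2)$, and $\inf\emptyset=+\infty$. If $\partial\Omega$ is connected, then for every $u\in BV(\Omega)$, as an identity in $[0,+\infty]$, $$F(u)=\sup\Big\{\int_\Omega\psi\cdot Du^\perp\ :\ \psi\in C_c^0(\Omega;\mathbb{R}^2),\ \exists\,\varphi\in C_c^1(\Omega\times\mathbb{S}^1),\ \underline\theta\cdot(\nabla_x\varphi+\psi)+f^*(\partial_\theta\varphi)\le0\ \text{ on }\Omega\times\mathbb{S}^1\Big\}.$$ If $\partial\Omega$ is not connected, then the same formula holds for every $u\in BV(\Omega)$ with the condition $\varphi\in C_c^1(\Omega\times\mathbb{S}^1)$ replaced by: $\varphi\in C^1(\Omega\times\mathbb{S}^1)$ and $\nabla\varphi\in C_c^0(\Omega\times\mathbb{S}^1;\mathbb{R}^3)$.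 -/

import Mathlib

open MeasureTheory Set Filter Topology
open scoped ENNReal NNReal Real

noncomputable section

namespace RotoTranslation

/-- The plane `ℝ²` with its Euclidean structure. -/
abbrev Plane := EuclideanSpace ℝ (Fin 2)

/-- The circle `𝕊¹ = ℝ / 2πℤ` of angles. -/
abbrev S1 := AddCircle (2 * π)

/-- The roto-translation space `ℝ² × 𝕊¹`, with points `(x, θ)`. -/
abbrev RTSpace := Plane × S1

/-- `ℝ³ = ℝ² × ℝ` with its Euclidean structure; a vector is written `p = (p^x, p^θ)`,
with `p^x = p.fst` and `p^θ = p.snd`. -/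
abbrev Vec3 := WithLp 2 (Plane × ℝ)

/-- The part `Ω × 𝕊¹` of the roto-translation space above `Ω`. -/
def lift (Ω : Set Plane) : Set RTSpace := Ω ×ˢ (univ : Set S1)

/-- The unit vector `(cos θ, sin θ)`. -/
def dir (θ : S1) : Plane := !₂[Real.Angle.cos θ, Real.Angle.sin θ]

/-- The rotation `x ↦ x^⊥ = (x₂, -x₁)` by 90 degrees. -/
def perp : Plane →L[ℝ] Plane :=
  LinearMap.toContinuousLinearMap
    { toFun := fun x => !₂[x 1, -x 0]
      map_add' := fun x y => by
        ext i; fin_cases i <;> simp [add_comm]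
      map_smul' := fun c x => by
        ext i; fin_cases i <;> simp }

/-! ### Test functions -/

/-- `ψ ∈ C_c^0(Ω; ℝ²)`. -/
structure IsCc (Ω : Set Plane) (ψ : Plane → Plane) : Prop where
  continuous : Continuous ψ
  hasCompactSupport : HasCompactSupport ψ
  tsupport_subset : tsupport ψ ⊆ Ω

/-- `ψ ∈ C_c^1(Ω; ℝ²)`. -/
structure IsCc1 (Ω : Set Plane) (ψ : Plane → Plane) : Prop where
  contDiff : ContDiff ℝ 1 ψ
  hasCompactSupport : HasCompactSupport ψ
  tsupport_subset : tsupport ψ ⊆ Ω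

/-- The divergence of a planar vector field. -/
def divergence (ψ : Plane → Plane) (x : Plane) : ℝ :=
  ∑ i, fderiv ℝ ψ x (EuclideanSpace.single i 1) i

/-- A function on `ℝ² × 𝕊¹`, read as a function on `ℝ² × ℝ` that is `2π`-periodic in the
last variable. -/
def unroll (φ : RTSpace → ℝ) : Plane × ℝ → ℝ := fun q => φ (q.1, (q.2 : S1))

/-- `∇_x φ`. -/
def gradX (φ : RTSpace → ℝ) (p : RTSpace) : Plane := gradient (fun y => φ (y, p.2)) p.1

/-- `∂_θ φ`. -/
def dTheta (φ : RTSpace → ℝ) (p : RTSpace) : ℝ :=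
  deriv (fun t : ℝ => φ (p.1, p.2 + (t : S1))) 0

/-- The full gradient `∇φ = (∇_x φ, ∂_θ φ)`. -/
def grad (φ : RTSpace → ℝ) (p : RTSpace) : Vec3 := WithLp.toLp 2 (gradX φ p, dTheta φ p)

/-- `φ ∈ C_c^1(Ω × 𝕊¹)`. -/
structure IsCc1RT (Ω : Set Plane) (φ : RTSpace → ℝ) : Prop where
  contDiff : ContDiff ℝ 1 (unroll φ)
  hasCompactSupport : HasCompactSupport φ
  tsupport_subset : tsupport φ ⊆ lift Ω

/-- `φ ∈ C^1(Ω × 𝕊¹)` with `∇φ ∈ C_c^0(Ω × 𝕊¹)`; the values of `φ` outside `Ω × 𝕊¹` play no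
role. -/
structure IsC1RTGradCc (Ω : Set Plane) (φ : RTSpace → ℝ) : Prop where
  contDiffOn : ContDiffOn ℝ 1 (unroll φ) (Ω ×ˢ (univ : Set ℝ))
  gradCompact : ∃ C : Set RTSpace, IsCompact C ∧ C ⊆ lift Ω ∧ ∀ p ∈ lift Ω \ C, grad φ p = 0

/-! ### Vector measures -/

/-- The integral `∫ η · dμ` of a vector field against a vector measure. -/
def pairing {X E : Type*} [MeasurableSpace X] [NormedAddCommGroup E] [InnerProductSpace ℝ E]
    (η : X → E) (μ : VectorMeasure X E) : ℝ :=
  ∫ᵛ x, η x ∂[innerSL ℝ; μ]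

/-- The signed measure `⟨v, σ⟩`, the component of the vector measure `σ` along `v`. -/
def component (σ : VectorMeasure RTSpace Vec3) (v : Vec3) : SignedMeasure RTSpace :=
  σ.mapRange (innerSL ℝ v).toLinearMap.toAddMonoidHom (innerSL ℝ v).continuous

/-- The Radon-Nikodym (Besicovitch) derivative `σ / |σ|` of `σ` with respect to its total
variation, computed in the canonical basis of `ℝ³`. -/
def density (σ : VectorMeasure RTSpace Vec3) (p : RTSpace) : Vec3 :=
  WithLp.toLp 2
    (!₂[(component σ (WithLp.toLp 2 (EuclideanSpace.single 0 1, 0))).rnDeriv σ.variation p,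
        (component σ (WithLp.toLp 2 (EuclideanSpace.single 1 1, 0))).rnDeriv σ.variation p],
      (component σ (WithLp.toLp 2 (0, 1))).rnDeriv σ.variation p)

/-- `Du` is the distributional derivative of `u` on `Ω`, and a bounded `ℝ²`-valued Radon measure
on `Ω` (represented by a vector measure on the plane that is concentrated on `Ω`).
Thus `u ∈ L¹(Ω)` belongs to `BV(Ω)` if and only if there is such a `Du`. -/
structure IsBVDerivative (Ω : Set Plane) (u : Plane → ℝ) (Du : VectorMeasure Plane Plane) :
    Prop where
  finite : IsFiniteMeasure Du.variation
  concentrated : Du.variation Ωᶜ = 0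
  integral_eq : ∀ φ : Plane → Plane, IsCc1 Ω φ →
    pairing φ Du = -∫ x in Ω, u x * divergence φ x

/-- The rotated measure `Du^⊥`. -/
def perpMeasure (Du : VectorMeasure Plane Plane) : VectorMeasure Plane Plane :=
  Du.mapRange perp.toLinearMap.toAddMonoidHom perp.continuous

/-! ### The functional -/

/-- The recession function `f^∞(t) = lim_{s → +∞} f(s t) / s`.
(For a convex `f` the limit exists; hence it is written as an upper limit.) -/
def recession (f : ℝ → ℝ≥0∞) (t : ℝ) : ℝ≥0∞ :=
  limsup (fun s : ℝ => f (s * t) / ENNReal.ofReal s) atTop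

/-- The convex conjugate `f^*(s) = sup_t (s t - f(t))`. -/
def conj (f : ℝ → ℝ≥0∞) (s : ℝ) : EReal :=
  ⨆ t : ℝ, (((s * t : ℝ) : EReal) - ((f t : ℝ≥0∞) : EReal))

open scoped Classical in
/-- The integrand `h(θ, p)`: it is `|p^x| f(p^θ / |p^x|)` if `p^x ≠ 0` is a nonnegative multiple
of `(cos θ, sin θ)`, it is `f^∞(p^θ)` if `p^x = 0`, and `+∞` otherwise. -/
def h (f : ℝ → ℝ≥0∞) (θ : S1) (p : Vec3) : ℝ≥0∞ :=
  if p.fst = 0 then recession f p.snd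
  else if ∃ c : ℝ, 0 ≤ c ∧ p.fst = c • dir θ then
    ENNReal.ofReal ‖p.fst‖ * f (p.snd / ‖p.fst‖)
  else ∞

/-- `∫_{Ω × 𝕊¹} h(θ, σ) = ∫ h(θ, σ / |σ|) d|σ|`. -/
def energy (f : ℝ → ℝ≥0∞) (σ : VectorMeasure RTSpace Vec3) : ℝ≥0∞ :=
  ∫⁻ p, h f p.2 (density σ p) ∂σ.variation

/-- `σ` is a bounded `ℝ³`-valued Radon measure on `Ω × 𝕊¹` (a vector measure concentrated on
that set) with `div σ = 0` in `Ω × 𝕊¹` and `∫_{𝕊¹} σ^x dθ = Du^⊥` in `Ω`, both in the sense of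
distributions. -/
structure Admissible (Ω : Set Plane) (u : Plane → ℝ) (σ : VectorMeasure RTSpace Vec3) :
    Prop where
  finite : IsFiniteMeasure σ.variation
  concentrated : σ.variation (lift Ω)ᶜ = 0
  div_eq_zero : ∀ φ : RTSpace → ℝ, IsCc1RT Ω φ → pairing (grad φ) σ = 0
  marginal_eq : ∀ φ : Plane → Plane, IsCc1 Ω φ →
    pairing (fun p : RTSpace => (WithLp.toLp 2 (perp (φ p.1), (0 : ℝ)) : Vec3)) σ
      = -∫ x in Ω, u x * divergence φ x

/-- The total roto-translational variation
`F(u) = inf { ∫ h(θ, σ) : div σ = 0, ∫_{𝕊¹} σ^x dθ = Du^⊥ }`. -/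
def F (Ω : Set Plane) (f : ℝ → ℝ≥0∞) (u : Plane → ℝ) : ℝ≥0∞ :=
  ⨅ (σ : VectorMeasure RTSpace Vec3) (_ : Admissible Ω u σ), energy f σ

/-! ### The dual problem -/

/-- The pointwise constraint `θ · (∇_x φ + ψ) + f^*(∂_θ φ) ≤ 0` on `Ω × 𝕊¹`. -/
def DualConstraint (Ω : Set Plane) (f : ℝ → ℝ≥0∞) (ψ : Plane → Plane) (φ : RTSpace → ℝ) : Prop :=
  ∀ x ∈ Ω, ∀ θ : S1,
    ((inner ℝ (dir θ) (gradX φ (x, θ) + ψ x) : ℝ) : EReal) + conj f (dTheta φ (x, θ)) ≤ 0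

/-- The supremum of `∫ ψ · Du^⊥` over the `ψ ∈ C_c^0(Ω; ℝ²)` for which the constraint holds with
some `φ` of the class `P`. -/
def dualSup (Ω : Set Plane) (f : ℝ → ℝ≥0∞) (Du : VectorMeasure Plane Plane)
    (P : (RTSpace → ℝ) → Prop) : EReal :=
  ⨆ (ψ : Plane → Plane) (_ : IsCc Ω ψ ∧ ∃ φ : RTSpace → ℝ, P φ ∧ DualConstraint Ω f ψ φ),
    ((pairing ψ (perpMeasure Du) : ℝ) : EReal)

end RotoTranslation

end

/-! The infimum and the supremum are dual linear problems. The dual constraint says that `(θ · (∇_x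
φ + ψ), ∂_θ φ)` is the coefficient pair of an affine minorant of `f` (`add_conj_le_zero_iff`), so
the field `(∇_x φ + ψ, ∂_θ φ)` pairs with any `p` to at most `h(θ, p)` (`ofReal_inner_le_h`).
Integrating against an admissible `σ` kills `∇φ` and leaves `∫ ψ · Du^⊥`; this is weak duality
(`dualSup_le_F`).

For the converse, let the dual value be a finite `M`; an admissible `σ` of energy at most `M` has to
be built. Up to scaling, `h(θ, ·)` is finite only in directions `(cos α (cos θ, sin θ), sin α)` with
`cos α ≥ 0`, and there it is the closed perspective `persp` of `f`, a supremum of linear functions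
of `(cos α, sin α)`. Pairs `(φ, ψ)` become test functions of `(x, θ, α)`, and `(φ, ψ) ↦ ∫ ψ · Du^⊥`
is bounded by `M` times the gauge of the functions below `persp` (`pairFunctional_le`). Hahn-Banach
extends it to a positive functional (`exists_positive_extension`), Riesz-Markov turns this into a
measure, and `∫ persp ≤ M` (`lintegral_persp_le`). Averaging the directions over `α` gives an
admissible `σ` (`admissible_projMeasure`), and a Jensen inequality bounds its energy
(`energy_le_lintegral_persp`).

If only `∇φ` has compact support, subtracting `g = φ(·, 0)` from `φ` and adding `∇g` to `ψ` gives a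
compactly supported `φ` and the same constraint. The value is unchanged because compactly supported
gradients are orthogonal to `Du^⊥` (`pairing_gradient_perpMeasure`). Hence both dual problems have
the same value (`dualSup_eq`). -/

noncomputable section

namespace RotoTranslation

/-! ### Integration of bounded fields against vector measures -/

section General

variable {X Z E : Type*} [MeasurableSpace X] [MeasurableSpace Z] [NormedAddCommGroup E]

/-- A property of bounded strongly measurable functions holds for all of them as soon as it holds for
indicators and is stable under sums and under bounded pointwise limits. -/
theorem bounded_stronglyMeasurable_induction {P : (X → E) → Prop}
    (h_ind : ∀ (c : E) (B : Set X), MeasurableSet B → P (B.indicator fun _ => c))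
    (h_add : ∀ (f g : X → E), StronglyMeasurable f → StronglyMeasurable g →
      (∃ C, ∀ x, ‖f x‖ ≤ C) → (∃ C, ∀ x, ‖g x‖ ≤ C) → P f → P g → P (f + g))
    (h_lim : ∀ (F : ℕ → X → E) (f : X → E) (C : ℝ), (∀ n, StronglyMeasurable (F n)) →
      (∀ n x, ‖F n x‖ ≤ C) → (∀ x, Tendsto (fun n => F n x) atTop (𝓝 (f x))) →
      (∀ n, P (F n)) → P f)
    (f : X → E) (hf : StronglyMeasurable f) (C : ℝ) (hC : ∀ x, ‖f x‖ ≤ C)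
    [NormedSpace ℝ E] : P f := by
  have hs : ∀ s : SimpleFunc X E, P s := by
    intro s
    induction s using SimpleFunc.induction with
    | @const c s hB =>
      convert h_ind c _ hB using 1
      funext x
      by_cases hx : x ∈ s <;> simp [SimpleFunc.piecewise_apply, hx]
    | @add f g _ hf hg =>
      exact h_add f g f.stronglyMeasurable g.stronglyMeasurable
        f.exists_forall_norm_le g.exists_forall_norm_le hf hg
  by_cases hne : Nonempty X
  · have h0 : 0 ≤ C := (norm_nonneg _).trans (hC hne.some)
    exact h_lim (fun n => hf.approxBounded C n) f C (fun n => (hf.approxBounded C n).stronglyMeasurable)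
      (fun n x => hf.norm_approxBounded_le h0 n x)
      (fun x => hf.tendsto_approxBounded_of_norm_le (hC x)) (fun n => hs _)
  · have : f = (SimpleFunc.const X (0 : E) : X → E) := by
      funext x; exact absurd ⟨x⟩ hne
    rw [this]; exact hs _

variable [InnerProductSpace ℝ E]

theorem pairing_indicator (σ : VectorMeasure X E) [IsFiniteMeasure σ.variation] (c : E)
    {B : Set X} (hB : MeasurableSet B) :
    pairing (B.indicator fun _ => c) σ = inner ℝ c (σ B) := by
  unfold pairing
  rw [VectorMeasure.integral_eq_setToFun, setToFun_indicator_const _ hB (measure_ne_top _ _)]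
  rfl

omit [InnerProductSpace ℝ E] in
theorem integrable_of_bounded {ν : Measure X} [IsFiniteMeasure ν] {f : X → E}
    (hf : StronglyMeasurable f) (hC : ∃ C, ∀ x, ‖f x‖ ≤ C) : Integrable f ν := by
  obtain ⟨C, hC⟩ := hC
  exact Integrable.of_bound hf.aestronglyMeasurable C (Eventually.of_forall hC)

theorem pairing_add (σ : VectorMeasure X E) {f g : X → E}
    (hf : Integrable f σ.variation) (hg : Integrable g σ.variation) :
    pairing (f + g) σ = pairing f σ + pairing g σ :=
  VectorMeasure.integral_add hf hg

theorem pairing_smul (σ : VectorMeasure X E) (c : ℝ) (f : X → E) :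
    pairing (c • f) σ = c * pairing f σ :=
  VectorMeasure.integral_smul f σ _ c

theorem tendsto_pairing (σ : VectorMeasure X E) [IsFiniteMeasure σ.variation]
    {F : ℕ → X → E} {f : X → E} {C : ℝ} (hF : ∀ n, StronglyMeasurable (F n))
    (hC : ∀ n x, ‖F n x‖ ≤ C) (h : ∀ x, Tendsto (fun n => F n x) atTop (𝓝 (f x))) :
    Tendsto (fun n => pairing (F n) σ) atTop (𝓝 (pairing f σ)) :=
  tendsto_setToFun_of_dominated_convergence _ (fun _ => C) (fun n => (hF n).aestronglyMeasurable)
    (integrable_const C) (fun n => Eventually.of_forall (hC n)) (Eventually.of_forall h)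

/-- If `σ` is the image under `q` of the measure with density `v` with respect to `ν`, then
`∫ η · dσ = ∫ ⟨η ∘ q, v⟩ dν`. -/
theorem pairing_eq_integral [CompleteSpace E] (σ : VectorMeasure X E)
    [IsFiniteMeasure σ.variation] (ν : Measure Z)
    {q : Z → X} (hq : Measurable q) {v : Z → E} (hv : Integrable v ν)
    (hσ : ∀ B, MeasurableSet B → σ B = ∫ z in q ⁻¹' B, v z ∂ν)
    {η : X → E} (hη : StronglyMeasurable η) (hC : ∃ C, ∀ x, ‖η x‖ ≤ C) :
    pairing η σ = ∫ z, inner ℝ (η (q z)) (v z) ∂ν := by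
  have hint : ∀ f : X → E, StronglyMeasurable f → (∃ C, ∀ x, ‖f x‖ ≤ C) →
      Integrable (fun z => inner ℝ (f (q z)) (v z)) ν := by
    rintro f hf ⟨C, hC⟩
    refine (hv.norm.const_mul C).mono'
      ((hf.comp_measurable hq).aestronglyMeasurable.inner hv.aestronglyMeasurable)
      (Eventually.of_forall fun z => ?_)
    exact (norm_inner_le_norm _ _).trans (mul_le_mul_of_nonneg_right (hC _) (norm_nonneg _))
  obtain ⟨C, hC⟩ := hC
  refine bounded_stronglyMeasurable_induction
    (P := fun η => pairing η σ = ∫ z, inner ℝ (η (q z)) (v z) ∂ν) ?_ ?_ ?_ η hη C hC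
  · intro c B hB
    rw [pairing_indicator σ c hB, hσ B hB, ← integral_inner hv.integrableOn,
      ← integral_indicator (hq hB)]
    refine integral_congr_ae (Eventually.of_forall fun z => ?_)
    by_cases hz : q z ∈ B <;> simp [indicator, hz]
  · intro f g hf hg hf' hg' h1 h2
    rw [pairing_add σ (integrable_of_bounded hf hf') (integrable_of_bounded hg hg'), h1, h2,
      ← integral_add (hint f hf hf') (hint g hg hg')]
    simp [inner_add_left]
  · intro F f C hF hC hlim h
    refine tendsto_nhds_unique (tendsto_pairing σ hF hC hlim) ?_
    simp_rw [h]
    refine tendsto_integral_of_dominated_convergence (fun z => C * ‖v z‖)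
      (fun n => (hint _ (hF n) ⟨C, hC n⟩).aestronglyMeasurable) (hv.norm.const_mul C)
      (fun n => Eventually.of_forall fun z => ?_) (Eventually.of_forall fun z => ?_)
    · exact (norm_inner_le_norm _ _).trans
        (mul_le_mul_of_nonneg_right (hC n _) (norm_nonneg _))
    · exact (hlim (q z)).inner tendsto_const_nhds

end General

/-! ### Rotation by 90 degrees and the polar density -/

theorem inner_perp (x y : Plane) : inner ℝ x (perp y) = -inner ℝ (perp x) y := by
  simp [perp, PiLp.inner_apply, Fin.sum_univ_two]

theorem norm_perp (x : Plane) : ‖perp x‖ = ‖x‖ := by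
  simp [perp, EuclideanSpace.norm_eq, Fin.sum_univ_two, add_comm]

theorem perp_perp (x : Plane) : perp (perp x) = -x := by
  ext i; fin_cases i <;> simp [perp]

instance finite_variation_perpMeasure (Du : VectorMeasure Plane Plane)
    [IsFiniteMeasure Du.variation] : IsFiniteMeasure (perpMeasure Du).variation := by
  refine isFiniteMeasure_of_le Du.variation (VectorMeasure.variation_le_of_forall_enorm_le ?_)
  intro B _
  refine le_trans (le_of_eq ?_) (VectorMeasure.enorm_measure_le_variation Du B)
  change ‖perp (Du B)‖ₑ = _
  rw [← ofReal_norm, norm_perp, ofReal_norm]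

/-- The adjoint of the rotation is its negative. -/
theorem pairing_perpMeasure (Du : VectorMeasure Plane Plane) [IsFiniteMeasure Du.variation]
    {ψ : Plane → Plane} (hψ : StronglyMeasurable ψ) (hC : ∃ C, ∀ x, ‖ψ x‖ ≤ C) :
    pairing ψ (perpMeasure Du) = pairing (fun x => -perp (ψ x)) Du := by
  have hm : ∀ f : Plane → Plane, StronglyMeasurable f →
      StronglyMeasurable fun x => -perp (f x) :=
    fun f hf => (perp.continuous.comp_stronglyMeasurable hf).neg
  have hb : ∀ f : Plane → Plane, (∃ C, ∀ x, ‖f x‖ ≤ C) → ∃ C, ∀ x, ‖-perp (f x)‖ ≤ C :=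
    fun f ⟨C, hC⟩ => ⟨C, fun x => by rw [norm_neg, norm_perp]; exact hC x⟩
  obtain ⟨C, hC⟩ := hC
  refine bounded_stronglyMeasurable_induction
    (P := fun ψ => pairing ψ (perpMeasure Du) = pairing (fun x => -perp (ψ x)) Du) ?_ ?_ ?_ ψ hψ C hC
  · intro c B hB
    have : (fun x => -perp (B.indicator (fun _ => c) x)) = B.indicator fun _ => -perp c := by
      funext x; by_cases hx : x ∈ B <;> simp [hx]
    rw [this, pairing_indicator _ _ hB, pairing_indicator _ _ hB, inner_neg_left, ← inner_perp]
    rfl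
  · intro f g hf hg hf' hg' h1 h2
    rw [pairing_add _ (integrable_of_bounded hf hf') (integrable_of_bounded hg hg'), h1, h2,
      ← pairing_add _ (integrable_of_bounded (hm f hf) (hb f hf'))
        (integrable_of_bounded (hm g hg) (hb g hg'))]
    congr 1; funext x; simp [add_comm]
  · intro F f C hF hC hlim h
    refine tendsto_nhds_unique (tendsto_pairing _ hF hC hlim) ?_
    simp_rw [h]
    refine tendsto_pairing (C := C) Du (fun n => hm _ (hF n))
      (fun n x => by rw [norm_neg, norm_perp]; exact hC n x) fun x => ?_
    exact ((perp.continuous.tendsto _).comp (hlim x)).neg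

theorem component_apply (σ : VectorMeasure RTSpace Vec3) (v : Vec3) (B : Set RTSpace) :
    component σ v B = inner ℝ v (σ B) := rfl

theorem component_setIntegral (σ : VectorMeasure RTSpace Vec3) [IsFiniteMeasure σ.variation]
    (v : Vec3) {B : Set RTSpace} (hB : MeasurableSet B) :
    ∫ p in B, (component σ v).rnDeriv σ.variation p ∂σ.variation = inner ℝ v (σ B) := by
  have hac : component σ v ≪ᵥ σ.variation.toENNRealVectorMeasure := by
    refine VectorMeasure.AbsolutelyContinuous.mk fun s hs h0 => ?_
    rw [Measure.toENNRealVectorMeasure_apply_measurable hs] at h0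
    have : ‖σ s‖ₑ ≤ 0 := h0 ▸ VectorMeasure.enorm_measure_le_variation σ s
    rw [component_apply, enorm_eq_zero.1 (le_antisymm this zero_le), inner_zero_right]
  rw [← withDensityᵥ_apply (SignedMeasure.integrable_rnDeriv _ _) hB,
    SignedMeasure.withDensityᵥ_rnDeriv_eq _ _ hac, component_apply]

theorem measurable_density (σ : VectorMeasure RTSpace Vec3) : Measurable (density σ) := by
  unfold density
  refine (WithLp.measurable_toLp 2 _).comp (Measurable.prodMk ?_ (SignedMeasure.measurable_rnDeriv _ _))
  refine (WithLp.measurable_toLp 2 _).comp (measurable_pi_lambda _ fun i => ?_)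
  fin_cases i <;> exact SignedMeasure.measurable_rnDeriv _ _

theorem integrable_density (σ : VectorMeasure RTSpace Vec3) :
    Integrable (density σ) σ.variation := by
  unfold density
  have h : ∀ g : RTSpace → Plane × ℝ, Integrable g σ.variation →
      Integrable (fun p => (WithLp.toLp 2 (g p) : Vec3)) σ.variation := fun g hg =>
    ((WithLp.prodContinuousLinearEquiv 2 ℝ Plane ℝ).symm : (Plane × ℝ) →L[ℝ] Vec3).integrable_comp hg
  refine h _ (Integrable.prodMk ?_ (SignedMeasure.integrable_rnDeriv _ _))
  refine ((EuclideanSpace.equiv (Fin 2) ℝ).symm : (Fin 2 → ℝ) →L[ℝ] Plane).integrable_comp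
    (Integrable.of_eval fun i => ?_)
  fin_cases i <;> exact SignedMeasure.integrable_rnDeriv _ _

theorem setIntegral_density (σ : VectorMeasure RTSpace Vec3) [IsFiniteMeasure σ.variation]
    {B : Set RTSpace} (hB : MeasurableSet B) :
    ∫ p in B, density σ p ∂σ.variation = σ B := by
  have key : ∀ v : Vec3, (∀ p, inner ℝ v (density σ p) = (component σ v).rnDeriv σ.variation p) →
      inner ℝ v (∫ p in B, density σ p ∂σ.variation) = inner ℝ v (σ B) := by
    intro v hv
    rw [← integral_inner (integrable_density σ).integrableOn, ← component_setIntegral σ v hB]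
    simp_rw [hv]
  have h0 := key (WithLp.toLp 2 (EuclideanSpace.single 0 1, 0)) fun p => by
    simp [density, EuclideanSpace.inner_single_left]
  have h1 := key (WithLp.toLp 2 (EuclideanSpace.single 1 1, 0)) fun p => by
    simp [density, EuclideanSpace.inner_single_left]
  have h2 := key (WithLp.toLp 2 (0, 1)) fun p => by simp [density]
  simp only [WithLp.prod_inner_apply, EuclideanSpace.inner_single_left, inner_zero_left] at h0 h1 h2
  refine WithLp.ofLp_injective 2 (Prod.ext ?_ ?_)
  · ext i; fin_cases i
    · simpa using h0
    · simpa using h1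
  · simpa using h2

/-- On the zero set of the density, `σ` vanishes on every measurable subset, hence so does its
variation. The value `p = 0` must be excluded in the energy bound: `recession f 0` is `∞` when `f 0
= ∞`, whereas the closed perspective vanishes at the origin. -/
theorem density_ne_zero (σ : VectorMeasure RTSpace Vec3) [IsFiniteMeasure σ.variation] :
    ∀ᵐ p ∂σ.variation, density σ p ≠ 0 := by
  have hm : MeasurableSet {p | density σ p = 0} :=
    measurable_density σ (measurableSet_singleton 0)
  rw [ae_iff]
  simp only [not_not]
  rw [VectorMeasure.variation_apply_eq_zero hm]
  intro B hB hBm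
  rw [← setIntegral_density σ hBm]
  exact setIntegral_eq_zero_of_forall_eq_zero fun p hp => hB hp

theorem pairing_eq_integral_density (σ : VectorMeasure RTSpace Vec3)
    [IsFiniteMeasure σ.variation] {η : RTSpace → Vec3} (hη : StronglyMeasurable η)
    (hC : ∃ C, ∀ x, ‖η x‖ ≤ C) :
    pairing η σ = ∫ p, inner ℝ (η p) (density σ p) ∂σ.variation :=
  pairing_eq_integral σ σ.variation measurable_id (integrable_density σ)
    (fun _ hB => (setIntegral_density σ hB).symm) hη hC

/-! ### Affine minorants and the Fenchel inequality -/

/-- The pairs `(a, b)` such that the affine function `t ↦ a + b t` is below `f`. -/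
def minorants (f : ℝ → ℝ≥0∞) : Set (ℝ × ℝ) := {q | ∀ t, ENNReal.ofReal (q.1 + q.2 * t) ≤ f t}

/-- The support function of the set of affine minorants: the closed perspective of `f`. -/
def persp (f : ℝ → ℝ≥0∞) (c s : ℝ) : ℝ≥0∞ :=
  ⨆ q : minorants f, ENNReal.ofReal (q.1.1 * c + q.1.2 * s)

/-- Rewriting the constraint through minorants removes the extended-real conjugate from all later
arguments. Positivity of `f` is what allows `ENNReal.ofReal` to truncate negative values of the
affine function. -/
theorem add_conj_le_zero_iff (f : ℝ → ℝ≥0∞) (a s : ℝ) :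
    (a : EReal) + conj f s ≤ 0 ↔ (a, s) ∈ minorants f := by
  have h1 : ∀ c : EReal, (a : EReal) + c ≤ 0 ↔ c ≤ ((-a : ℝ) : EReal) := by
    intro c
    induction c with
    | bot => simp
    | top => simp [EReal.coe_ne_top, -EReal.coe_neg]
    | coe x =>
      rw [← EReal.coe_add, EReal.coe_le_coe_iff, ← EReal.coe_zero, EReal.coe_le_coe_iff]
      constructor <;> intro h <;> linarith
  rw [h1, conj, iSup_le_iff]
  refine forall_congr' fun t => ?_
  generalize f t = y
  induction y with
  | top => simp
  | coe r =>
    have h2 : ((r : ℝ≥0∞) : EReal) = ((r : ℝ) : EReal) := rfl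
    rw [h2, ← EReal.coe_sub, EReal.coe_le_coe_iff, ← ENNReal.ofReal_coe_nnreal,
      ENNReal.ofReal_le_ofReal_iff r.coe_nonneg]
    constructor <;> intro h <;> linarith

theorem dualConstraint_iff (Ω : Set Plane) (f : ℝ → ℝ≥0∞) (ψ : Plane → Plane)
    (φ : RTSpace → ℝ) : DualConstraint Ω f ψ φ ↔ ∀ x ∈ Ω, ∀ θ : S1,
      (inner ℝ (dir θ) (gradX φ (x, θ) + ψ x), dTheta φ (x, θ)) ∈ minorants f := by
  simp only [DualConstraint, add_conj_le_zero_iff]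

theorem norm_dir (θ : S1) : ‖dir θ‖ = 1 := by
  have := Real.Angle.cos_sq_add_sin_sq θ
  simp [dir, EuclideanSpace.norm_eq, Fin.sum_univ_two, this]

theorem ofReal_mul_le_recession {f : ℝ → ℝ≥0∞} {q : ℝ × ℝ} (hq : q ∈ minorants f) (s : ℝ) :
    ENNReal.ofReal (q.2 * s) ≤ recession f s := by
  have hlim : Tendsto (fun r : ℝ => ENNReal.ofReal (q.1 / r + q.2 * s)) atTop
      (𝓝 (ENNReal.ofReal (q.2 * s))) := by
    refine ENNReal.tendsto_ofReal ?_
    simpa using (tendsto_const_nhds.div_atTop tendsto_id).add_const (q.2 * s)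
  rw [← hlim.limsup_eq]
  refine limsup_le_limsup ?_
  filter_upwards [eventually_gt_atTop 0] with r hr
  have : q.1 / r + q.2 * s = (q.1 + q.2 * (r * s)) / r := by field_simp
  rw [this, ENNReal.ofReal_div_of_pos hr]
  exact ENNReal.div_le_div_right (hq _) _

/-- The Fenchel inequality for the integrand. -/
theorem ofReal_inner_le_h {f : ℝ → ℝ≥0∞} (θ : S1) {η p : Vec3}
    (hη : (inner ℝ (dir θ) η.fst, η.snd) ∈ minorants f) :
    ENNReal.ofReal (inner ℝ η p) ≤ h f θ p := by
  rw [WithLp.prod_inner_apply]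
  unfold h
  split_ifs with h0 h1
  · have := ofReal_mul_le_recession hη p.snd
    simp only [WithLp.ofLp_fst, WithLp.ofLp_snd, h0, inner_zero_right, zero_add] at this ⊢
    simpa [mul_comm] using this
  · obtain ⟨c, hc, hp⟩ := h1
    have hc0 : c ≠ 0 := by rintro rfl; simp at hp; exact h0 hp
    have hn : ‖p.fst‖ = c := by rw [hp, norm_smul, norm_dir, mul_one, Real.norm_of_nonneg hc]
    have hcp : 0 < c := lt_of_le_of_ne hc hc0.symm
    rw [hn]
    refine le_trans (le_of_eq ?_) (mul_le_mul_right (hη (p.snd / c)) _)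
    rw [← ENNReal.ofReal_mul hc]
    congr 1
    simp only [WithLp.ofLp_fst, WithLp.ofLp_snd]
    rw [hp, inner_smul_right, real_inner_comm]
    simp only [RCLike.inner_apply, conj_trivial]
    field_simp
  · exact le_top

/-! ### Convex duality for `f` and its closed perspective -/

section Convex

variable {f : ℝ → ℝ≥0∞}

theorem zero_mem_minorants (f : ℝ → ℝ≥0∞) : ((0, 0) : ℝ × ℝ) ∈ minorants f := fun t => by simp

/-- The point `(t₀, r₀)` is strictly separated from the closed convex epigraph of `f`; solving the
equation of the hyperplane for the vertical variable gives the minorant, unless the hyperplane is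
vertical. -/
theorem exists_minorant_gt (hf : ConvexOn ℝ≥0 univ f) (hlsc : LowerSemicontinuous f)
    {t₀ r₀ : ℝ} (hr : 0 ≤ r₀) (h : ENNReal.ofReal r₀ < f t₀) :
    ∃ q ∈ minorants f, r₀ ≤ q.1 + q.2 * t₀ := by
  set C : Set (ℝ × ℝ) := {p | 0 ≤ p.2 ∧ f p.1 ≤ ENNReal.ofReal p.2} with hC
  have hclosed : IsClosed C := by
    have h1 : IsClosed {p : ℝ × ℝ≥0∞ | f p.1 ≤ p.2} := hlsc.isClosed_epigraph
    exact (isClosed_le continuous_const continuous_snd).inter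
      (h1.preimage (f := fun p : ℝ × ℝ => (p.1, ENNReal.ofReal p.2))
        (continuous_fst.prodMk (ENNReal.continuous_ofReal.comp continuous_snd)))
  have hconv : Convex ℝ C := by
    rintro ⟨x, y⟩ ⟨hy, hxy⟩ ⟨x', y'⟩ ⟨hy', hxy'⟩ a b ha hb hab
    simp only at hy hxy hy' hxy'
    refine ⟨?_, ?_⟩
    · simp only [Prod.smul_mk, Prod.mk_add_mk, smul_eq_mul]; positivity
    · lift a to ℝ≥0 using ha
      lift b to ℝ≥0 using hb
      have hab' : a + b = 1 := by exact_mod_cast hab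
      have := hf.2 (mem_univ x) (mem_univ x') zero_le zero_le hab'
      refine (this.trans (add_le_add (smul_le_smul_of_nonneg_left hxy zero_le)
        (smul_le_smul_of_nonneg_left hxy' zero_le))).trans (le_of_eq ?_)
      simp only [ENNReal.smul_def, smul_eq_mul, Prod.smul_mk, Prod.mk_add_mk]
      rw [ENNReal.ofReal_add (by positivity) (by positivity), ENNReal.ofReal_mul a.coe_nonneg,
        ENNReal.ofReal_mul b.coe_nonneg]
      simp
  have hnot : (t₀, r₀) ∉ C := fun hmem => absurd hmem.2 (not_le.2 h)
  obtain ⟨L, u, hu, hL⟩ := geometric_hahn_banach_point_closed hconv hclosed hnot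
  set α := L (1, 0)
  set β := L (0, 1)
  have hLe : ∀ x y, L (x, y) = α * x + β * y := by
    intro x y
    have : ((x, y) : ℝ × ℝ) = x • (1, 0) + y • (0, 1) := by simp
    rw [this, map_add, map_smul, map_smul, smul_eq_mul, smul_eq_mul]; ring
  rw [hLe] at hu
  have hfin : ∀ t, f t ≠ ∞ → u < α * t + β * (f t).toReal := fun t ht => by
    rw [← hLe]
    exact hL _ ⟨ENNReal.toReal_nonneg, by rw [ENNReal.ofReal_toReal ht]⟩
  by_cases hne : ∃ t, f t ≠ ∞
  swap
  · push Not at hne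
    exact ⟨(r₀, 0), fun t => by simp [hne], by simp⟩
  obtain ⟨t₁, ht₁⟩ := hne
  -- The epigraph is unbounded upwards, so a negative vertical coefficient would violate the
  -- separation high above `t₁`.
  have hβ : 0 ≤ β := by
    by_contra! hneg
    have hN : ∀ y, (f t₁).toReal ≤ y → u < α * t₁ + β * y := fun y hy => by
      rw [← hLe]
      refine hL _ ⟨ENNReal.toReal_nonneg.trans hy, ?_⟩
      simpa [ENNReal.ofReal_toReal ht₁] using ENNReal.ofReal_le_ofReal hy
    have h2 := hN (max (f t₁).toReal ((u - α * t₁) / β)) (le_max_left _ _)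
    have h3 := mul_le_mul_of_nonpos_left (le_max_right (f t₁).toReal ((u - α * t₁) / β)) hneg.le
    rw [mul_div_cancel₀ _ hneg.ne] at h3
    linarith
  -- If `β = 0`, the affine function `u - α t` is negative on the domain of `f` and positive at
  -- `t₀`. A nonnegative multiple of it is still a minorant, and the factor is chosen to give
  -- exactly `r₀` at `t₀`.
  rcases hβ.eq_or_lt with h0 | hpos
  · rw [← h0] at hfin hu
    have hd : 0 < u - α * t₀ := by linarith
    refine ⟨(r₀ / (u - α * t₀) * u, -(r₀ / (u - α * t₀) * α)), fun t => ?_, ?_⟩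
    · by_cases ht : f t = ∞
      · simp [ht]
      · have h4 := hfin t ht
        rw [ENNReal.ofReal_of_nonpos]
        · exact zero_le
        · have : 0 ≤ r₀ / (u - α * t₀) := by positivity
          nlinarith
    · apply le_of_eq
      field_simp
      ring
  · refine ⟨(u / β, -(α / β)), fun t => ?_, ?_⟩
    · by_cases ht : f t = ∞
      · simp [ht]
      · have h4 := hfin t ht
        refine ENNReal.ofReal_le_of_le_toReal ?_
        have : u / β + -(α / β) * t = (u - α * t) / β := by field_simp; ring
        rw [this, div_le_iff₀ hpos]
        linarith
    · have : u / β + -(α / β) * t₀ = (u - α * t₀) / β := by field_simp; ring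
      simp only
      rw [this, le_div_iff₀ hpos]
      linarith

/-- A convex lower semicontinuous function is the supremum of its affine minorants. -/
theorem le_persp_one (hf : ConvexOn ℝ≥0 univ f) (hlsc : LowerSemicontinuous f) (t : ℝ) :
    f t ≤ persp f 1 t := by
  refine le_of_forall_lt fun r hr => ?_
  obtain ⟨r', h1, h2⟩ := exists_between hr
  have hne : r' ≠ ∞ := h2.ne_top
  obtain ⟨q, hq, hle⟩ := exists_minorant_gt hf hlsc (r₀ := r'.toReal) ENNReal.toReal_nonneg
    (by rwa [ENNReal.ofReal_toReal hne])
  refine lt_of_lt_of_le h1 ?_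
  refine le_trans ?_ (le_iSup _ (⟨q, hq⟩ : minorants f))
  rw [mul_one, ← ENNReal.ofReal_toReal hne]
  exact ENNReal.ofReal_le_ofReal hle

/-- Every minorant has slope at most `r = persp f 0 s` along `s`, so starting from a point `x₀` of
the domain, `f` grows at most linearly with rate `r` in that direction. Dividing by the parameter
leaves `r` in the limit. -/
theorem recession_le_persp (hf : ConvexOn ℝ≥0 univ f) (hlsc : LowerSemicontinuous f) {s : ℝ}
    (hs : s ≠ 0) : recession f s ≤ persp f 0 s := by
  by_cases htop : persp f 0 s = ∞
  · simp [htop]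
  have hb : ∀ q ∈ minorants f, q.2 * s ≤ (persp f 0 s).toReal := fun q hq => by
    have := le_iSup (fun q : minorants f => ENNReal.ofReal (q.1.1 * 0 + q.1.2 * s)) ⟨q, hq⟩
    simp only [mul_zero, zero_add] at this
    refine (ENNReal.ofReal_le_iff_le_toReal htop).1 (this.trans (le_of_eq ?_))
    simp [persp]
  set r := (persp f 0 s).toReal
  -- If `f` were identically `∞`, every slope would be allowed, contradicting the bound `r`.
  obtain ⟨x₀, hx₀⟩ : ∃ x, f x ≠ ∞ := by
    by_contra! hall
    have h1 := hb (0, (r + 1) / s) fun t => by simp [hall]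
    simp only at h1
    rw [div_mul_cancel₀ _ hs] at h1
    linarith
  have hle : ∀ k : ℝ, x₀ / s ≤ k →
      f (k * s) ≤ ENNReal.ofReal ((f x₀).toReal + r * (k - x₀ / s)) := by
    intro k hk
    refine (le_persp_one hf hlsc _).trans (iSup_le fun q => ENNReal.ofReal_le_ofReal ?_)
    have h1 : q.1.1 + q.1.2 * x₀ ≤ (f x₀).toReal :=
      (ENNReal.ofReal_le_iff_le_toReal hx₀).1 (q.2 x₀)
    have h2 := mul_le_mul_of_nonneg_right (hb q.1 q.2) (sub_nonneg.2 hk)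
    have h3 : q.1.2 * s * (k - x₀ / s) = q.1.2 * (k * s) - q.1.2 * x₀ := by field_simp
    linarith
  have hlim : Tendsto (fun k : ℝ => ENNReal.ofReal (((f x₀).toReal - r * (x₀ / s)) / k + r)) atTop
      (𝓝 (ENNReal.ofReal r)) := by
    refine ENNReal.tendsto_ofReal ?_
    simpa using (tendsto_const_nhds.div_atTop tendsto_id).add_const r
  rw [← ENNReal.ofReal_toReal htop]
  change limsup _ atTop ≤ ENNReal.ofReal r
  rw [← hlim.limsup_eq]
  refine limsup_le_limsup ?_
  filter_upwards [eventually_gt_atTop 0, eventually_ge_atTop (x₀ / s)] with k hk hk'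
  refine (ENNReal.div_le_div_right (hle k hk') _).trans (le_of_eq ?_)
  rw [← ENNReal.ofReal_div_of_pos hk]
  congr 1
  field_simp
  ring

theorem persp_smul {c : ℝ} (hc : 0 ≤ c) (a s : ℝ) :
    ENNReal.ofReal c * persp f a s = persp f (c * a) (c * s) := by
  unfold persp
  rw [ENNReal.mul_iSup]
  refine iSup_congr fun q => ?_
  rw [← ENNReal.ofReal_mul hc]
  congr 1
  ring

/-- The integrand is bounded by the closed perspective, on the directions where it may be finite. -/
theorem h_le_persp (hf : ConvexOn ℝ≥0 univ f) (hlsc : LowerSemicontinuous f) (θ : S1) {p : Vec3}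
    (hp : p ≠ 0) {c : ℝ} (hc : 0 ≤ c) (hpc : p.fst = c • dir θ) : h f θ p ≤ persp f c p.snd := by
  have hn : ‖p.fst‖ = c := by rw [hpc, norm_smul, norm_dir, mul_one, Real.norm_of_nonneg hc]
  unfold h
  split_ifs with h0 h1
  · have hc0 : c = 0 := by rw [← hn, h0, norm_zero]
    rw [hc0]
    refine recession_le_persp hf hlsc fun hs => hp ?_
    exact WithLp.ofLp_injective 2 (Prod.ext h0 hs)
  · have hc0 : c ≠ 0 := by rintro rfl; simp at hn; exact h0 hn
    rw [hn]
    refine (mul_le_mul_right (le_persp_one hf hlsc _) _).trans (le_of_eq ?_)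
    rw [persp_smul hc, mul_one, mul_div_cancel₀ _ hc0]
  · exact absurd ⟨c, hc, hpc⟩ h1

/-- Separability of the set of minorants makes the supremum countable, as needed for measurability
and monotone convergence. -/
theorem exists_seq_persp (f : ℝ → ℝ≥0∞) : ∃ q : ℕ → minorants f, ∀ c s,
    persp f c s = ⨆ n, ENNReal.ofReal ((q n).1.1 * c + (q n).1.2 * s) := by
  have : Nonempty (minorants f) := ⟨⟨_, zero_mem_minorants f⟩⟩
  refine ⟨TopologicalSpace.denseSeq (minorants f), fun c s => le_antisymm (iSup_le ?_)
    (iSup_le fun n => le_iSup (fun q : minorants f => ENNReal.ofReal (q.1.1 * c + q.1.2 * s)) _)⟩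
  intro q
  refine (TopologicalSpace.denseRange_denseSeq (minorants f)).induction_on
    (p := fun q : minorants f => ENNReal.ofReal (q.1.1 * c + q.1.2 * s) ≤ _) q ?_ ?_
  · exact isClosed_le (ENNReal.continuous_ofReal.comp (by fun_prop)) continuous_const
  · exact fun n => le_iSup (fun n => ENNReal.ofReal
      ((TopologicalSpace.denseSeq (minorants f) n).1.1 * c +
        (TopologicalSpace.denseSeq (minorants f) n).1.2 * s)) n

/-- By homogeneity the bound on the unit circle passes to all `(1, t)`, reached at the angle `arctan
t`; there the closed perspective is at most `f t`. -/
theorem mem_minorants_of_forall_le_persp {q : ℝ × ℝ}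
    (hq : ∀ α : S1, ENNReal.ofReal (q.1 * Real.Angle.cos α + q.2 * Real.Angle.sin α) ≤
      persp f (Real.Angle.cos α) (Real.Angle.sin α)) : q ∈ minorants f := by
  intro t
  have h1 := hq ((Real.arctan t : ℝ) : Real.Angle)
  rw [Real.Angle.cos_coe, Real.Angle.sin_coe] at h1
  have hc : 0 < Real.cos (Real.arctan t) := Real.cos_arctan_pos t
  have hs : Real.sin (Real.arctan t) = Real.cos (Real.arctan t) * t := by
    conv_rhs => rw [← Real.tan_arctan t, Real.arctan_tan (Real.neg_pi_div_two_lt_arctan t) (Real.arctan_lt_pi_div_two t)]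
    rw [mul_comm, Real.tan_mul_cos hc.ne']
  have h2 := persp_smul (f := f) hc.le 1 t
  rw [mul_one, ← hs] at h2
  have h3 : q.1 * Real.cos (Real.arctan t) + q.2 * Real.sin (Real.arctan t) =
      Real.cos (Real.arctan t) * (q.1 + q.2 * t) := by rw [hs]; ring
  rw [h3, ← h2, ENNReal.ofReal_mul hc.le] at h1
  have h4 := (ENNReal.mul_le_mul_iff_right (ENNReal.ofReal_pos.2 hc).ne' ENNReal.ofReal_ne_top).1 h1
  exact h4.trans (iSup_le fun p => by simpa using p.2 t)

/-- By Cauchy-Schwarz, `γ (cos α, sin α)` is itself a minorant, and it takes the value `γ` at `α`.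
This coercivity makes the gauge below finite. -/
theorem le_persp_of_le {γ : ℝ} (hγ : 0 < γ)
    (hbelow : ∀ t : ℝ, ENNReal.ofReal (γ * √(1 + t ^ 2)) ≤ f t) (α : S1) :
    ENNReal.ofReal γ ≤ persp f (Real.Angle.cos α) (Real.Angle.sin α) := by
  have h1 := Real.Angle.cos_sq_add_sin_sq α
  set c := Real.Angle.cos α
  set s := Real.Angle.sin α
  have hq : (γ * c, γ * s) ∈ minorants f := fun t => by
    refine le_trans (ENNReal.ofReal_le_ofReal ?_) (hbelow t)
    have : c + s * t ≤ √(1 + t ^ 2) := by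
      refine Real.le_sqrt_of_sq_le ?_
      nlinarith [sq_nonneg (c * t - s)]
    simp only
    nlinarith
  refine le_trans (le_of_eq ?_) (le_iSup _ (⟨_, hq⟩ : minorants f))
  congr 1
  simp only
  linear_combination -γ * h1

/-- Since `f ≥ 0`, all nonpositive constants are minorants. Hence finiteness of `∫ persp` forces a
measure onto `cos α ≥ 0`, the half of the circle where `p^x` points along `+θ`. -/
theorem persp_eq_top_of_neg {c : ℝ} (hc : c < 0) (s : ℝ) : persp f c s = ∞ := by
  refine ENNReal.eq_top_of_forall_nnreal_le fun r => ?_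
  have hq : ((r / c, 0) : ℝ × ℝ) ∈ minorants f := fun t => by
    rw [ENNReal.ofReal_of_nonpos]
    · exact zero_le
    · simpa using div_nonpos_of_nonneg_of_nonpos r.coe_nonneg hc.le
  refine le_trans (le_of_eq ?_) (le_iSup _ (⟨_, hq⟩ : minorants f))
  simp [div_mul_cancel₀ _ hc.ne]

theorem measurable_persp (f : ℝ → ℝ≥0∞) : Measurable fun p : ℝ × ℝ => persp f p.1 p.2 := by
  obtain ⟨q, hq⟩ := exists_seq_persp f
  simp_rw [hq]
  exact Measurable.iSup fun n => by fun_prop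

end Convex

/-! ### Calculus and test functions on the roto-translation space -/

section TestFunctions

variable {Ω : Set Plane}

theorem isOpenQuotientMap_unroll :
    IsOpenQuotientMap (fun q : Plane × ℝ => ((q.1, (q.2 : S1)) : RTSpace)) :=
  IsOpenQuotientMap.id.prodMap QuotientAddGroup.isOpenQuotientMap_mk

theorem gradX_eq {φ : RTSpace → ℝ} {x : Plane} {t : ℝ}
    (hφ : DifferentiableAt ℝ (unroll φ) (x, t)) :
    gradX φ (x, (t : S1)) = (InnerProductSpace.toDual ℝ Plane).symm
      ((fderiv ℝ (unroll φ) (x, t)).comp (ContinuousLinearMap.inl ℝ Plane ℝ)) := by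
  have h1 : HasFDerivAt (fun y : Plane => ((y, t) : Plane × ℝ))
      (ContinuousLinearMap.inl ℝ Plane ℝ) x := hasFDerivAt_prodMk_left x t
  have h2 := HasFDerivAt.comp x (g := unroll φ) hφ.hasFDerivAt h1
  unfold gradX gradient
  exact congrArg _ h2.fderiv

theorem dTheta_eq {φ : RTSpace → ℝ} {x : Plane} {t : ℝ}
    (hφ : DifferentiableAt ℝ (unroll φ) (x, t)) :
    dTheta φ (x, (t : S1)) = fderiv ℝ (unroll φ) (x, t) (0, 1) := by
  have h1 : HasDerivAt (fun s : ℝ => ((x, t + s) : Plane × ℝ)) (0, 1) 0 :=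
    (hasDerivAt_const (0 : ℝ) x).prodMk ((hasDerivAt_id (0 : ℝ)).const_add t)
  have h2 : HasFDerivAt (unroll φ) (fderiv ℝ (unroll φ) (x, t)) (x, t + 0) := by
    rw [add_zero]; exact hφ.hasFDerivAt
  exact (h2.comp_hasDerivAt (0 : ℝ) h1).deriv

theorem grad_unroll {φ : RTSpace → ℝ} {q : Plane × ℝ}
    (hφ : DifferentiableAt ℝ (unroll φ) q) :
    grad φ (q.1, (q.2 : S1)) = WithLp.toLp 2 ((InnerProductSpace.toDual ℝ Plane).symm
      ((fderiv ℝ (unroll φ) q).comp (ContinuousLinearMap.inl ℝ Plane ℝ)),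
        fderiv ℝ (unroll φ) q (0, 1)) := by
  unfold grad
  rw [gradX_eq hφ, dTheta_eq hφ]

theorem continuous_grad {φ : RTSpace → ℝ} (hφ : ContDiff ℝ 1 (unroll φ)) :
    Continuous (grad φ) := by
  refine isOpenQuotientMap_unroll.isQuotientMap.continuous_iff.2 ?_
  have h1 : Continuous (fderiv ℝ (unroll φ)) := hφ.continuous_fderiv one_ne_zero
  have h2 : (grad φ ∘ fun q : Plane × ℝ => ((q.1, (q.2 : S1)) : RTSpace)) = fun q =>
      WithLp.toLp 2 ((InnerProductSpace.toDual ℝ Plane).symm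
      ((fderiv ℝ (unroll φ) q).comp (ContinuousLinearMap.inl ℝ Plane ℝ)),
        fderiv ℝ (unroll φ) q (0, 1)) := by
    funext q
    exact grad_unroll (hφ.differentiable one_ne_zero q)
  rw [h2]
  refine (WithLp.prod_continuous_toLp 2 Plane ℝ).comp (Continuous.prodMk ?_ ?_)
  · exact (LinearIsometryEquiv.continuous _).comp (h1.clm_comp continuous_const)
  · exact h1.clm_apply continuous_const

theorem grad_congr {φ φ' : RTSpace → ℝ} {p : RTSpace} (h : φ =ᶠ[𝓝 p] φ') :
    grad φ p = grad φ' p := by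
  have h1 : (fun y => φ (y, p.2)) =ᶠ[𝓝 p.1] fun y => φ' (y, p.2) :=
    (Continuous.prodMk_left p.2).tendsto p.1 h
  have h2 : (fun t : ℝ => φ (p.1, p.2 + (t : S1))) =ᶠ[𝓝 0] fun t : ℝ => φ' (p.1, p.2 + (t : S1)) := by
    have : Continuous fun t : ℝ => ((p.1, p.2 + (t : S1)) : RTSpace) := by
      refine continuous_const.prodMk (continuous_const.add ?_)
      exact AddCircle.continuous_mk' _
    have h3 := this.tendsto 0
    simp only [AddCircle.coe_zero, add_zero] at h3
    exact h3 h
  unfold grad gradX dTheta gradient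
  rw [h1.fderiv_eq, h2.deriv_eq]

theorem grad_zero (p : RTSpace) : grad (fun _ => (0 : ℝ)) p = 0 := by
  unfold grad gradX dTheta gradient
  simp

theorem grad_eq_zero_of_notMem_tsupport {φ : RTSpace → ℝ} {p : RTSpace} (hp : p ∉ tsupport φ) :
    grad φ p = 0 := by
  rw [grad_congr (φ' := fun _ => 0) (notMem_tsupport_iff_eventuallyEq.1 hp), grad_zero]

theorem differentiableAt_gradX {φ : RTSpace → ℝ} (hφ : ContDiff ℝ 1 (unroll φ)) (p : RTSpace) :
    DifferentiableAt ℝ (fun y => φ (y, p.2)) p.1 := by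
  obtain ⟨⟨x, t⟩, rfl⟩ := isOpenQuotientMap_unroll.surjective p
  have h1 : DifferentiableAt ℝ (fun y : Plane => ((y, t) : Plane × ℝ)) x := by fun_prop
  exact DifferentiableAt.comp x (g := unroll φ) (hφ.differentiable one_ne_zero (x, t)) h1

theorem differentiableAt_dTheta {φ : RTSpace → ℝ} (hφ : ContDiff ℝ 1 (unroll φ)) (p : RTSpace) :
    DifferentiableAt ℝ (fun t : ℝ => φ (p.1, p.2 + (t : S1))) 0 := by
  obtain ⟨⟨x, t⟩, rfl⟩ := isOpenQuotientMap_unroll.surjective p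
  exact DifferentiableAt.comp (0 : ℝ) (g := unroll φ) (hφ.differentiable one_ne_zero _)
    ((differentiableAt_const x).prodMk (differentiableAt_id.const_add t))

theorem grad_add {φ φ' : RTSpace → ℝ} (hφ : ContDiff ℝ 1 (unroll φ))
    (hφ' : ContDiff ℝ 1 (unroll φ')) (p : RTSpace) :
    grad (φ + φ') p = grad φ p + grad φ' p := by
  unfold grad gradX dTheta gradient
  simp only [Pi.add_apply]
  rw [fderiv_fun_add (differentiableAt_gradX hφ p) (differentiableAt_gradX hφ' p), map_add,
    deriv_fun_add (differentiableAt_dTheta hφ p) (differentiableAt_dTheta hφ' p)]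
  rfl

theorem grad_smul {φ : RTSpace → ℝ} (hφ : ContDiff ℝ 1 (unroll φ)) (c : ℝ) (p : RTSpace) :
    grad (c • φ) p = c • grad φ p := by
  unfold grad gradX dTheta gradient
  simp only [Pi.smul_apply]
  rw [fderiv_fun_const_smul (differentiableAt_gradX hφ p), map_smul,
    deriv_fun_const_smul _ (differentiableAt_dTheta hφ p)]
  rfl

theorem IsCc1.isCc {ψ : Plane → Plane} (h : IsCc1 Ω ψ) : IsCc Ω ψ :=
  ⟨h.contDiff.continuous, h.hasCompactSupport, h.tsupport_subset⟩

theorem tsupport_add_subset {X E : Type*} [TopologicalSpace X] [AddZeroClass E] (f g : X → E) :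
    tsupport (f + g) ⊆ tsupport f ∪ tsupport g := by
  unfold tsupport
  rw [← closure_union]
  exact closure_mono (Function.support_add f g)

theorem IsCc.zero : IsCc Ω 0 :=
  ⟨continuous_const, HasCompactSupport.zero, by simp [tsupport]⟩

theorem IsCc.add {ψ ψ' : Plane → Plane} (h : IsCc Ω ψ) (h' : IsCc Ω ψ') : IsCc Ω (ψ + ψ') :=
  ⟨h.continuous.add h'.continuous, h.hasCompactSupport.add h'.hasCompactSupport,
    (tsupport_add_subset _ _).trans (union_subset h.tsupport_subset h'.tsupport_subset)⟩

theorem IsCc.smul {ψ : Plane → Plane} (h : IsCc Ω ψ) (c : ℝ) : IsCc Ω (c • ψ) :=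
  have hs : tsupport (c • ψ) ⊆ tsupport ψ := closure_mono (Function.support_const_smul_subset c ψ)
  ⟨h.continuous.const_smul c, h.hasCompactSupport.of_isClosed_subset (isClosed_tsupport _) hs,
    hs.trans h.tsupport_subset⟩

theorem IsCc.perp {ψ : Plane → Plane} (h : IsCc Ω ψ) : IsCc Ω fun x => perp (ψ x) :=
  have hs : tsupport (fun x => RotoTranslation.perp (ψ x)) ⊆ tsupport ψ :=
    closure_mono fun x hx hx' => hx (by simp [hx'])
  ⟨RotoTranslation.perp.continuous.comp h.continuous,
    h.hasCompactSupport.of_isClosed_subset (isClosed_tsupport _) hs, hs.trans h.tsupport_subset⟩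

theorem IsCc.exists_bound {ψ : Plane → Plane} (h : IsCc Ω ψ) : ∃ C, ∀ x, ‖ψ x‖ ≤ C :=
  h.continuous.bounded_above_of_compact_support h.hasCompactSupport

theorem IsCc1RT.zero : IsCc1RT Ω 0 :=
  ⟨contDiff_const, HasCompactSupport.zero, by simp [tsupport]⟩

theorem IsCc1RT.add {φ φ' : RTSpace → ℝ} (h : IsCc1RT Ω φ) (h' : IsCc1RT Ω φ') :
    IsCc1RT Ω (φ + φ') :=
  ⟨h.contDiff.add h'.contDiff, h.hasCompactSupport.add h'.hasCompactSupport,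
    (tsupport_add_subset _ _).trans (union_subset h.tsupport_subset h'.tsupport_subset)⟩

theorem IsCc1RT.smul {φ : RTSpace → ℝ} (h : IsCc1RT Ω φ) (c : ℝ) : IsCc1RT Ω (c • φ) :=
  have hs : tsupport (c • φ) ⊆ tsupport φ := closure_mono (Function.support_const_smul_subset c φ)
  ⟨h.contDiff.const_smul c, h.hasCompactSupport.of_isClosed_subset (isClosed_tsupport _) hs,
    hs.trans h.tsupport_subset⟩

theorem IsCc1RT.exists_bound_grad {φ : RTSpace → ℝ} (h : IsCc1RT Ω φ) :
    ∃ C, ∀ p, ‖grad φ p‖ ≤ C :=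
  (continuous_grad h.contDiff).bounded_above_of_compact_support
    (h.hasCompactSupport.of_isClosed_subset (isClosed_tsupport _) (closure_minimal
      (fun _ hp => by_contra fun h' => hp (grad_eq_zero_of_notMem_tsupport h'))
      (isClosed_tsupport _)))

theorem IsCc1RT.isC1RTGradCc {φ : RTSpace → ℝ} (h : IsCc1RT Ω φ) : IsC1RTGradCc Ω φ :=
  ⟨h.contDiff.contDiffOn, tsupport φ, h.hasCompactSupport, h.tsupport_subset,
    fun _ hp => grad_eq_zero_of_notMem_tsupport hp.2⟩

/-- The distributional identities are only assumed for `C^1` fields; this bounded pointwise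
approximation carries them to continuous ones by dominated convergence. -/
theorem IsCc.exists_approx {ψ : Plane → Plane} (h : IsCc Ω ψ) :
    ∃ F : ℕ → Plane → Plane, (∀ n, IsCc1 Ω (F n)) ∧ (∃ C, ∀ n x, ‖F n x‖ ≤ C) ∧
      ∀ x, Tendsto (fun n => F n x) atTop (𝓝 (ψ x)) := by
  have key : ∀ n : ℕ, ∃ g : Plane → Plane, ContDiff ℝ 1 g ∧
      (∀ x, dist (g x) (ψ x) < 1 / ((n : ℝ) + 1)) ∧ Function.support g ⊆ Function.support ψ :=
    fun n => h.continuous.exists_contDiff_approx 1 (ε := fun _ => 1 / ((n : ℝ) + 1))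
      continuous_const fun _ => Nat.one_div_pos_of_nat
  choose F hF hd hs using key
  obtain ⟨C, hC⟩ := h.exists_bound
  refine ⟨F, fun n => ⟨hF n, h.hasCompactSupport.of_isClosed_subset (isClosed_tsupport _)
    (closure_mono (hs n)), (closure_mono (hs n)).trans h.tsupport_subset⟩,
    ⟨C + 1, fun n x => ?_⟩, fun x => ?_⟩
  · have h1 := hd n x
    rw [dist_eq_norm] at h1
    have h2 : 1 / ((n : ℝ) + 1) ≤ 1 := by
      rw [div_le_one (by positivity)]; linarith [(n.cast_nonneg : (0 : ℝ) ≤ n)]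
    have h3 := norm_add_le (F n x - ψ x) (ψ x)
    rw [sub_add_cancel] at h3
    linarith [hC x]
  · rw [tendsto_iff_dist_tendsto_zero]
    exact squeeze_zero (fun _ => dist_nonneg) (fun n => (hd n x).le)
      tendsto_one_div_add_atTop_nhds_zero_nat

end TestFunctions

/-! ### Weak duality -/

section WeakDuality

variable {Ω : Set Plane} {u : Plane → ℝ} {Du : VectorMeasure Plane Plane}
  {σ : VectorMeasure RTSpace Vec3} {f : ℝ → ℝ≥0∞}

/-- A planar vector field, as a field on the roto-translation space without angular component. -/
def liftField (ψ : Plane → Plane) (p : RTSpace) : Vec3 := WithLp.toLp 2 (ψ p.1, (0 : ℝ))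

theorem norm_liftField (ψ : Plane → Plane) (p : RTSpace) : ‖liftField ψ p‖ = ‖ψ p.1‖ := by
  simp [liftField]

theorem continuous_liftField {ψ : Plane → Plane} (h : Continuous ψ) : Continuous (liftField ψ) :=
  (WithLp.prod_continuous_toLp 2 Plane ℝ).comp ((h.comp continuous_fst).prodMk continuous_const)

theorem Admissible.pairing_liftField (hσ : Admissible Ω u σ) (hDu : IsBVDerivative Ω u Du)
    {ψ : Plane → Plane} (hψ : IsCc Ω ψ) :
    pairing (liftField ψ) σ = pairing ψ (perpMeasure Du) := by
  have := hσ.finite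
  have := hDu.finite
  have hψm := hψ.continuous.stronglyMeasurable
  rw [pairing_perpMeasure Du hψm hψ.exists_bound]
  -- This is the field whose rotation is `ψ`; its `C^1` approximations are test fields both for `Du`
  -- and for the marginal condition.
  have hχ : IsCc Ω fun x => -perp (ψ x) := by
    have := hψ.perp.smul (-1)
    convert this using 1
    funext x; simp
  obtain ⟨F, hF, ⟨C, hC⟩, hlim⟩ := hχ.exists_approx
  have h1 := tendsto_pairing Du (fun n => (hF n).isCc.continuous.stronglyMeasurable) hC hlim
  have h2 : Tendsto (fun n => pairing (liftField fun x => perp (F n x)) σ) atTop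
      (𝓝 (pairing (liftField ψ) σ)) := by
    refine tendsto_pairing σ (C := C) (fun n => (continuous_liftField
      (perp.continuous.comp (hF n).isCc.continuous)).stronglyMeasurable)
      (fun n p => by rw [norm_liftField, norm_perp]; exact hC n p.1) fun p => ?_
    have h3 := (perp.continuous.tendsto _).comp (hlim p.1)
    rw [map_neg, perp_perp, neg_neg] at h3
    exact ((WithLp.prod_continuous_toLp 2 Plane ℝ).tendsto _).comp (h3.prodMk_nhds tendsto_const_nhds)
  refine tendsto_nhds_unique h2 (h1.congr fun n => ?_)
  exact (hDu.integral_eq _ (hF n)).trans (hσ.marginal_eq _ (hF n)).symm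

theorem coe_le_coe_ennreal_iff {x : ℝ} {e : ℝ≥0∞} :
    (x : EReal) ≤ (e : EReal) ↔ ENNReal.ofReal x ≤ e := by
  rw [← EReal.coe_ennreal_le_coe_ennreal_iff, EReal.coe_ennreal_ofReal,
    EReal.coe_strictMono.monotone.map_max, max_le_iff]
  exact ⟨fun hx => ⟨hx, EReal.coe_ennreal_nonneg e⟩, fun hx => hx.1⟩

theorem ofReal_integral_le_lintegral {X : Type*} [MeasurableSpace X] {μ : Measure X} {g : X → ℝ}
    (hg : Integrable g μ) : ENNReal.ofReal (∫ x, g x ∂μ) ≤ ∫⁻ x, ENNReal.ofReal (g x) ∂μ := by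
  have h1 : ∫ x, g x ∂μ ≤ ∫ x, max (g x) 0 ∂μ :=
    integral_mono hg hg.pos_part fun x => le_max_left _ _
  refine (ENNReal.ofReal_le_ofReal h1).trans (le_of_eq ?_)
  rw [ofReal_integral_eq_lintegral_ofReal hg.pos_part
    (Eventually.of_forall fun x => le_max_right _ _)]
  refine lintegral_congr fun x => ?_
  rw [ENNReal.ofReal_max]; simp

theorem Admissible.ofReal_pairing_le_energy (hσ : Admissible Ω u σ) (hDu : IsBVDerivative Ω u Du)
    {ψ : Plane → Plane} (hψ : IsCc Ω ψ) {φ : RTSpace → ℝ} (hφ : IsCc1RT Ω φ)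
    (hc : DualConstraint Ω f ψ φ) :
    ENNReal.ofReal (pairing ψ (perpMeasure Du)) ≤ energy f σ := by
  have := hσ.finite
  have hgm := (continuous_grad hφ.contDiff).stronglyMeasurable
  have hlm := (continuous_liftField hψ.continuous).stronglyMeasurable
  obtain ⟨C, hC⟩ := hφ.exists_bound_grad
  obtain ⟨C', hC'⟩ := hψ.exists_bound
  have hlb : ∀ p, ‖liftField ψ p‖ ≤ C' := fun p => by rw [norm_liftField]; exact hC' _
  have hηb : ∀ p, ‖(grad φ + liftField ψ) p‖ ≤ C + C' := fun p =>
    (norm_add_le _ _).trans (add_le_add (hC p) (hlb p))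
  have h1 : pairing ψ (perpMeasure Du) = pairing (grad φ + liftField ψ) σ := by
    rw [pairing_add σ (integrable_of_bounded hgm ⟨C, hC⟩) (integrable_of_bounded hlm ⟨C', hlb⟩),
      hσ.div_eq_zero φ hφ, hσ.pairing_liftField hDu hψ, zero_add]
  rw [h1, pairing_eq_integral_density σ (hgm.add hlm) ⟨_, hηb⟩]
  have hint : Integrable (fun p => (inner ℝ ((grad φ + liftField ψ) p) (density σ p) : ℝ))
      σ.variation := by
    refine ((integrable_density σ).norm.const_mul (C + C')).mono'
      ((hgm.add hlm).aestronglyMeasurable.inner (integrable_density σ).aestronglyMeasurable)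
      (Eventually.of_forall fun p => ?_)
    exact (norm_inner_le_norm _ _).trans (mul_le_mul_of_nonneg_right (hηb p) (norm_nonneg _))
  refine (ofReal_integral_le_lintegral hint).trans (lintegral_mono_ae ?_)
  have hae : ∀ᵐ p ∂σ.variation, p ∈ lift Ω := by
    rw [ae_iff]; exact hσ.concentrated
  rw [dualConstraint_iff] at hc
  filter_upwards [hae] with p hp
  refine ofReal_inner_le_h p.2 ?_
  have := hc p.1 hp.1 p.2
  simpa [grad, liftField] using this

theorem dualSup_le_F (hDu : IsBVDerivative Ω u Du) :
    dualSup Ω f Du (IsCc1RT Ω) ≤ ((F Ω f u : ℝ≥0∞) : EReal) := by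
  refine iSup₂_le fun ψ ⟨hψ, φ, hφ, hc⟩ => coe_le_coe_ennreal_iff.2 ?_
  exact le_iInf₂ fun σ hσ => hσ.ofReal_pairing_le_energy hDu hψ hφ hc

end WeakDuality

/-! ### Compactly supported gradients are orthogonal to `Du^⊥` -/

section CurlFree

open scoped Convolution
open ContinuousLinearMap

variable {Ω : Set Plane} {u : Plane → ℝ} {Du : VectorMeasure Plane Plane}

theorem tsupport_subset_of_forall {X E : Type*} [TopologicalSpace X] [Zero E] {f : X → E}
    {s : Set X} (hs : IsClosed s) (h : ∀ x ∉ s, f x = 0) : tsupport f ⊆ s :=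
  closure_minimal (fun x hx => by_contra fun hx' => hx (h x hx')) hs

theorem toDual_symm_apply_coord (L : Plane →L[ℝ] ℝ) (i : Fin 2) :
    (InnerProductSpace.toDual ℝ Plane).symm L i = L (EuclideanSpace.single i 1) := by
  rw [← InnerProductSpace.toDual_symm_apply (𝕜 := ℝ) (x := EuclideanSpace.single i 1) (y := L),
    EuclideanSpace.inner_single_right]
  simp

/-- The linear map taking a covector to its rotated representative. -/
def rotDual : (Plane →L[ℝ] ℝ) →L[ℝ] Plane :=
  LinearMap.toContinuousLinearMap
    { toFun := fun L => -perp ((InnerProductSpace.toDual ℝ Plane).symm L)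
      map_add' := fun L L' => by simp [add_comm]
      map_smul' := fun c L => by simp }

theorem rotDual_apply (L : Plane →L[ℝ] ℝ) :
    rotDual L = -perp ((InnerProductSpace.toDual ℝ Plane).symm L) := rfl

/-- A rotated gradient is divergence free by symmetry of the Hessian. -/
theorem divergence_rotDual_fderiv {Θ : Plane → ℝ} {ω : Plane → Plane →L[ℝ] ℝ} {x : Plane}
    (hΘ : ContDiffAt ℝ 2 Θ x) (h : ω =ᶠ[𝓝 x] fderiv ℝ Θ) :
    divergence (fun y => rotDual (ω y)) x = 0 := by
  have hd : DifferentiableAt ℝ (fderiv ℝ Θ) x :=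
    (hΘ.fderiv_right (m := 1) (by norm_num)).differentiableAt one_ne_zero
  have h1 : fderiv ℝ (fun y => rotDual (ω y)) x = rotDual.comp (fderiv ℝ (fderiv ℝ Θ) x) := by
    have h2 : (fun y => rotDual (ω y)) =ᶠ[𝓝 x] fun y => rotDual (fderiv ℝ Θ y) := by
      filter_upwards [h] with y hy
      rw [hy]
    rw [h2.fderiv_eq]
    exact (rotDual.hasFDerivAt.comp x hd.hasFDerivAt).fderiv
  have hsymm := hΘ.isSymmSndFDerivAt (by simp)
  unfold divergence
  rw [h1, Fin.sum_univ_two]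
  have := hsymm (EuclideanSpace.single 0 1) (EuclideanSpace.single 1 1)
  simp only [ContinuousLinearMap.comp_apply, rotDual_apply, perp]
  simp only [LinearMap.coe_toContinuousLinearMap', LinearMap.coe_mk, AddHom.coe_mk, PiLp.neg_apply,
    toDual_symm_apply_coord]
  simp only [Matrix.cons_val_zero, Matrix.cons_val_one]
  rw [this]
  ring

theorem normed_convolution_congr (ρ : ContDiffBump (0 : Plane)) {E : Type*}
    [NormedAddCommGroup E] [NormedSpace ℝ E] {g g' : Plane → E} {x : Plane}
    (h : ∀ y ∈ Metric.ball x ρ.rOut, g y = g' y) :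
    (ρ.normed volume ⋆[lsmul ℝ ℝ, volume] g) x = (ρ.normed volume ⋆[lsmul ℝ ℝ, volume] g') x := by
  rw [convolution_def, convolution_def]
  refine integral_congr_ae (Eventually.of_forall fun t => ?_)
  by_cases ht : t ∈ Function.support (ρ.normed volume)
  · rw [ρ.support_normed_eq] at ht
    simp only
    rw [h (x - t) (by simpa [Metric.mem_ball, dist_eq_norm] using ht)]
  · simp only
    rw [Function.notMem_support.1 ht]
    simp

theorem fderiv_normed_convolution (ρ : ContDiffBump (0 : Plane)) {Φ : Plane → ℝ}
    (hΦ : ContDiff ℝ 1 Φ) (hc : HasCompactSupport Φ) (x : Plane) :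
    fderiv ℝ (ρ.normed volume ⋆[lsmul ℝ ℝ, volume] Φ) x =
      (ρ.normed volume ⋆[lsmul ℝ ℝ, volume] fderiv ℝ Φ) x := by
  rw [(hc.hasFDerivAt_convolution_right (lsmul ℝ ℝ)
    ρ.continuous_normed.locallyIntegrable hΦ x).fderiv]
  rfl

/-- The function `g` is `C^1` only on `Ω` and need not have compact support, so it is cut off away
from `K`; the gradient is unchanged near `K`. -/
theorem exists_cutoff {K : Set Plane} (hK : IsCompact K) {g : Plane → ℝ} (hΩ : IsOpen Ω)
    (hKΩ : K ⊆ Ω) (hg : ContDiffOn ℝ 1 g Ω) :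
    ∃ (Φ : Plane → ℝ) (δ : ℝ), 0 < δ ∧ Metric.cthickening δ K ⊆ Ω ∧ ContDiff ℝ 1 Φ ∧
      HasCompactSupport Φ ∧ ∀ x ∈ Metric.cthickening δ K, fderiv ℝ Φ x = fderiv ℝ g x := by
  obtain ⟨δ, hδ, hδΩ⟩ := hK.exists_cthickening_subset_open hΩ hKΩ
  have hsub : Metric.cthickening (δ / 2) K ⊆ Metric.thickening δ K :=
    Metric.cthickening_subset_thickening' hδ (by linarith) K
  obtain ⟨χ, h1, h0, -⟩ := exists_contMDiffMap_one_nhds_of_subset_interior (n := 1)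
    (modelWithCornersSelf ℝ Plane) (s := Metric.cthickening (δ / 2) K)
    (t := Metric.cthickening δ K) Metric.isClosed_cthickening
    (hsub.trans (interior_maximal (Metric.thickening_subset_cthickening δ K)
      Metric.isOpen_thickening))
  have hχ : ContDiff ℝ 1 χ := χ.contMDiff.contDiff
  have hz : ∀ x ∉ Metric.cthickening δ K, (fun x => χ x * g x) x = 0 := fun x hx => by
    simp [h0 x hx]
  refine ⟨fun x => χ x * g x, δ / 2, by linarith,
    (Metric.cthickening_mono (by linarith) K).trans hδΩ, ?_,
    HasCompactSupport.intro hK.cthickening hz, fun x hx => ?_⟩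
  · rw [contDiff_iff_contDiffAt]
    intro x
    by_cases hx : x ∈ Ω
    · exact hχ.contDiffAt.mul (hg.contDiffAt (hΩ.mem_nhds hx))
    · have hx' : x ∉ Metric.cthickening δ K := fun h => hx (hδΩ h)
      have : (fun x => χ x * g x) =ᶠ[𝓝 x] fun _ => 0 := by
        filter_upwards [Metric.isClosed_cthickening.isOpen_compl.mem_nhds hx'] with y hy
        exact hz y hy
      exact (contDiffAt_const (c := (0 : ℝ))).congr_of_eventuallyEq this
  · have : (fun x => χ x * g x) =ᶠ[𝓝 x] g := by
      filter_upwards [(eventually_nhdsSet_iff_forall.1 h1) x hx] with y hy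
      rw [hy, one_mul]
    exact this.fderiv_eq

/-- A gradient with compact support is orthogonal to `Du^⊥`. -/
theorem pairing_gradient_perpMeasure (hΩ : IsOpen Ω) (hDu : IsBVDerivative Ω u Du)
    {g : Plane → ℝ} (hg : ContDiffOn ℝ 1 g Ω) {K : Set Plane} (hK : IsCompact K) (hKΩ : K ⊆ Ω)
    (h0 : ∀ x ∈ Ω \ K, fderiv ℝ g x = 0) :
    IsCc Ω (Ω.indicator (gradient g)) ∧ pairing (Ω.indicator (gradient g)) (perpMeasure Du) = 0 := by
  have := hDu.finite
  set ω : Plane → Plane →L[ℝ] ℝ := Ω.indicator (fderiv ℝ g) with hω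
  have hω0 : ∀ x ∉ K, ω x = 0 := fun x hx => by
    by_cases hxΩ : x ∈ Ω
    · rw [hω, indicator_of_mem hxΩ]; exact h0 x ⟨hxΩ, hx⟩
    · exact indicator_of_notMem hxΩ _
  have hωc : Continuous ω := by
    rw [continuous_iff_continuousAt]
    intro x
    by_cases hxΩ : x ∈ Ω
    · have h1 : ContinuousAt (fderiv ℝ g) x :=
        (hg.continuousOn_fderiv_of_isOpen hΩ le_rfl).continuousAt (hΩ.mem_nhds hxΩ)
      refine h1.congr ?_
      filter_upwards [hΩ.mem_nhds hxΩ] with y hy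
      exact (indicator_of_mem hy _).symm
    · have hxK : x ∉ K := fun h => hxΩ (hKΩ h)
      refine (continuousAt_const (y := (0 : Plane →L[ℝ] ℝ))).congr ?_
      filter_upwards [hK.isClosed.isOpen_compl.mem_nhds hxK] with y hy
      exact (hω0 y hy).symm
  have hωs : HasCompactSupport ω := HasCompactSupport.intro hK hω0
  have hV : Ω.indicator (gradient g) = fun x => (InnerProductSpace.toDual ℝ Plane).symm (ω x) := by
    funext x
    by_cases hxΩ : x ∈ Ω <;> simp [hω, hxΩ, gradient]
  have hVc : IsCc Ω (Ω.indicator (gradient g)) := by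
    have hz : ∀ x ∉ K, Ω.indicator (gradient g) x = 0 := fun x hx => by
      rw [hV]; simp [hω0 x hx]
    refine ⟨?_, HasCompactSupport.intro hK hz, (tsupport_subset_of_forall
      hK.isClosed hz).trans hKΩ⟩
    rw [hV]
    exact (LinearIsometryEquiv.continuous _).comp hωc
  refine ⟨hVc, ?_⟩
  rw [pairing_perpMeasure Du hVc.continuous.stronglyMeasurable hVc.exists_bound]
  obtain ⟨Φ, δ, hδ, hδΩ, hΦ, hΦc, hΦg⟩ := exists_cutoff hK hΩ hKΩ hg
  have hΦω : ∀ x ∈ Metric.cthickening δ K, fderiv ℝ Φ x = ω x := fun x hx => by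
    rw [hΦg x hx, hω, indicator_of_mem (hδΩ hx)]
  obtain ⟨C, hC⟩ := hωc.bounded_above_of_compact_support hωs
  -- The outer radius is at most `δ / 4`: if a ball of twice this radius meets `K`, it lies within
  -- `δ` of `K`, where `ω` is the derivative of `Φ`.
  set ρ : ℕ → ContDiffBump (0 : Plane) := fun n =>
    { rIn := δ / (8 * ((n : ℝ) + 1)), rOut := δ / (4 * ((n : ℝ) + 1)),
      rIn_pos := by positivity, rIn_lt_rOut := by gcongr; norm_num } with hρ
  have hr : ∀ n, (ρ n).rOut ≤ δ / 4 := fun n => by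
    simp only [hρ]
    gcongr
    linarith [(n.cast_nonneg : (0 : ℝ) ≤ n)]
  have hρ0 : Tendsto (fun n => (ρ n).rOut) atTop (𝓝 0) := by
    have := (tendsto_one_div_add_atTop_nhds_zero_nat (𝕜 := ℝ)).const_mul (δ / 4)
    rw [mul_zero] at this
    refine this.congr fun n => ?_
    simp only [hρ]
    field_simp
  set W : ℕ → Plane → Plane →L[ℝ] ℝ := fun n => (ρ n).normed volume ⋆[lsmul ℝ ℝ, volume] ω with hW
  have hWz : ∀ n x, (∀ y ∈ Metric.ball x (ρ n).rOut, y ∉ K) → W n x = 0 := fun n x hx => by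
    simp only [hW]
    rw [normed_convolution_congr (ρ n) (g' := 0) fun y hy => hω0 y (hx y hy), convolution_zero]
    rfl
  have hnear : ∀ {n x} {y : Plane}, y ∈ Metric.ball x (2 * (ρ n).rOut) → y ∈ K →
      ∀ z ∈ Metric.ball x (2 * (ρ n).rOut), z ∈ Metric.cthickening δ K := by
    intro n x y hy hyK z hz
    refine Metric.mem_cthickening_of_dist_le z y δ K hyK ?_
    have := dist_triangle_right z y x
    rw [Metric.mem_ball] at hy hz
    linarith [hr n]
  have hWcd : ∀ n, ContDiff ℝ 1 (W n) := fun n =>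
    (ρ n).hasCompactSupport_normed.contDiff_convolution_left (n := 1) _ (ρ n).contDiff_normed
      hωc.locallyIntegrable
  have hWs : ∀ n x, x ∉ Metric.cthickening δ K → W n x = 0 := fun n x hx => by
    refine hWz n x fun y hy hyK => hx ?_
    have h2 : Metric.ball x (ρ n).rOut ⊆ Metric.ball x (2 * (ρ n).rOut) :=
      Metric.ball_subset_ball (by linarith [(ρ n).rOut_pos])
    exact hnear (h2 hy) hyK x (Metric.mem_ball_self (by linarith [(ρ n).rOut_pos]))
  have hcc : ∀ n, IsCc1 Ω fun x => rotDual (W n x) := fun n => by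
    have hz : ∀ x ∉ Metric.cthickening δ K, rotDual (W n x) = 0 := fun x hx => by
      rw [hWs n x hx, map_zero]
    exact ⟨rotDual.contDiff.comp (hWcd n), HasCompactSupport.intro hK.cthickening hz,
      (tsupport_subset_of_forall Metric.isClosed_cthickening hz).trans hδΩ⟩
  have hdiv : ∀ n x, divergence (fun x => rotDual (W n x)) x = 0 := by
    intro n x
    have hrn := (ρ n).rOut_pos
    have hball : Metric.ball x (ρ n).rOut ∈ 𝓝 x := Metric.ball_mem_nhds x hrn
    have hsub : ∀ z ∈ Metric.ball x (ρ n).rOut, Metric.ball z (ρ n).rOut ⊆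
        Metric.ball x (2 * (ρ n).rOut) := fun z hz =>
      Metric.ball_subset_ball' (by rw [Metric.mem_ball] at hz; linarith)
    -- Near `K` the mollified `ω` is the derivative of the mollified `Φ`; away from `K` it vanishes.
    -- No global potential with compact support is required.
    by_cases hx : ∃ y ∈ Metric.ball x (2 * (ρ n).rOut), y ∈ K
    · obtain ⟨y, hy, hyK⟩ := hx
      refine divergence_rotDual_fderiv (Θ := (ρ n).normed volume ⋆[lsmul ℝ ℝ, volume] Φ)
        (((ρ n).hasCompactSupport_normed.contDiff_convolution_left (n := 2) _ (ρ n).contDiff_normed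
          hΦ.continuous.locallyIntegrable).contDiffAt) ?_
      filter_upwards [hball] with z hz
      rw [fderiv_normed_convolution (ρ n) hΦ hΦc]
      exact normed_convolution_congr (ρ n) fun a ha =>
        (hΦω a (hnear hy hyK a (hsub z hz ha))).symm
    · push Not at hx
      refine divergence_rotDual_fderiv (Θ := fun _ => 0) contDiffAt_const ?_
      filter_upwards [hball] with z hz
      rw [hWz n z fun a ha => hx a (hsub z hz ha)]
      simp
  have hlim : Tendsto (fun n => pairing (fun x => rotDual (W n x)) Du) atTop
      (𝓝 (pairing (fun x => -perp (Ω.indicator (gradient g) x)) Du)) := by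
    refine tendsto_pairing Du (C := 3 * C)
      (fun n => (hcc n).isCc.continuous.stronglyMeasurable) (fun n x => ?_) fun x => ?_
    · rw [rotDual_apply, norm_neg, norm_perp, LinearIsometryEquiv.norm_map]
      have hd : dist (W n x) (ω x) ≤ 2 * C :=
        ContDiffBump.dist_normed_convolution_le hωc.aestronglyMeasurable fun y _ => by
          rw [dist_eq_norm]
          exact (norm_sub_le _ _).trans (by linarith [hC x, hC y])
      rw [dist_eq_norm] at hd
      have h3 := norm_add_le (W n x - ω x) (ω x)
      rw [sub_add_cancel] at h3
      linarith [hC x]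
    · have h1 : Tendsto (fun n => W n x) atTop (𝓝 (ω x)) :=
        ContDiffBump.convolution_tendsto_right_of_continuous hρ0 hωc x
      simp only [hV]
      exact (rotDual.continuous.tendsto _).comp h1
  refine tendsto_nhds_unique hlim ?_
  refine tendsto_const_nhds.congr fun n => ?_
  rw [hDu.integral_eq _ (hcc n)]
  simp [hdiv n]

end CurlFree

/-! ### Reduction to compactly supported `φ` -/

section Reduction

variable {Ω : Set Plane} {u : Plane → ℝ} {Du : VectorMeasure Plane Plane} {f : ℝ → ℝ≥0∞}

theorem eq_of_dTheta_eq_zero {φ : RTSpace → ℝ} {x : Plane}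
    (hd : ∀ t : ℝ, DifferentiableAt ℝ (unroll φ) (x, t)) (h0 : ∀ θ : S1, dTheta φ (x, θ) = 0)
    (θ : S1) : φ (x, θ) = φ (x, 0) := by
  obtain ⟨t, rfl⟩ := QuotientAddGroup.mk_surjective θ
  have h1 : ∀ t : ℝ, HasDerivAt (fun s : ℝ => unroll φ (x, s)) (fderiv ℝ (unroll φ) (x, t) (0, 1)) t :=
    fun t => (hd t).hasFDerivAt.comp_hasDerivAt t
      ((hasDerivAt_const t x).prodMk (hasDerivAt_id t))
  exact is_const_of_deriv_eq_zero (fun t => (h1 t).differentiableAt)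
    (fun t => by rw [(h1 t).deriv, ← dTheta_eq (hd t), h0]) t 0

/-- The constraint depends only on `∇_x φ + ψ` and `∂_θ φ`, so a function of `x` alone can be moved
from `φ` to `ψ` as a gradient. -/
theorem IsC1RTGradCc.exists_isCc1RT (hΩ : IsOpen Ω) (hDu : IsBVDerivative Ω u Du)
    {φ : RTSpace → ℝ} (hφ : IsC1RTGradCc Ω φ) {ψ : Plane → Plane} (hψ : IsCc Ω ψ)
    (hc : DualConstraint Ω f ψ φ) :
    ∃ φ' ψ', IsCc1RT Ω φ' ∧ IsCc Ω ψ' ∧ DualConstraint Ω f ψ' φ' ∧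
      pairing ψ' (perpMeasure Du) = pairing ψ (perpMeasure Du) := by
  classical
  have := hDu.finite
  obtain ⟨C, hC, hCΩ, hC0⟩ := hφ.gradCompact
  set K : Set Plane := Prod.fst '' C with hKdef
  have hK : IsCompact K := hC.image continuous_fst
  have hKΩ : K ⊆ Ω := by rintro _ ⟨p, hp, rfl⟩; exact (hCΩ hp).1
  have hcd : ∀ x ∈ Ω, ∀ t : ℝ, ContDiffAt ℝ 1 (unroll φ) (x, t) := fun x hx t =>
    hφ.contDiffOn.contDiffAt ((hΩ.prod isOpen_univ).mem_nhds ⟨hx, mem_univ _⟩)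
  have hda : ∀ x ∈ Ω, ∀ t : ℝ, DifferentiableAt ℝ (unroll φ) (x, t) := fun x hx t =>
    (hcd x hx t).differentiableAt one_ne_zero
  have hgrad0 : ∀ x ∈ Ω \ K, ∀ θ, grad φ (x, θ) = 0 := fun x hx θ =>
    hC0 _ ⟨⟨hx.1, mem_univ _⟩, fun h => hx.2 ⟨_, h, rfl⟩⟩
  set g : Plane → ℝ := fun x => φ (x, 0) with hgdef
  have hgu : g = fun x => unroll φ (x, 0) := by
    funext x; simp [unroll, hgdef]
  have hg : ContDiffOn ℝ 1 g Ω := fun x hx => by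
    rw [hgu]
    exact ((hcd x hx 0).comp (f := fun y : Plane => (y, (0 : ℝ))) x (by fun_prop)).contDiffWithinAt
  have hgX : ∀ x, gradX φ (x, 0) = gradient g x := fun x => rfl
  have hg0 : ∀ x ∈ Ω \ K, fderiv ℝ g x = 0 := fun x hx => by
    have h1 : gradX φ (x, 0) = 0 := congrArg WithLp.fst (hgrad0 x hx 0)
    rw [hgX, gradient] at h1
    simpa using h1
  obtain ⟨hVc, hV0⟩ := pairing_gradient_perpMeasure hΩ hDu hg hK hKΩ hg0
  set φ' : RTSpace → ℝ := fun p => if p.1 ∈ Ω then φ p - g p.1 else 0 with hφ'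
  -- Over a point of `Ω` outside `K`, `φ` does not depend on the angle, hence equals its value `g`
  -- at angle `0`. Whether the locally constant `g` takes different values near different boundary
  -- components is immaterial.
  have hz : ∀ p : RTSpace, p.1 ∉ K → φ' p = 0 := fun p hp => by
    by_cases hpΩ : p.1 ∈ Ω
    · simp only [hφ', if_pos hpΩ, hgdef]
      rw [sub_eq_zero]
      exact eq_of_dTheta_eq_zero (hda p.1 hpΩ)
        (fun θ => congrArg WithLp.snd (hgrad0 p.1 ⟨hpΩ, hp⟩ θ)) p.2
    · simp only [hφ', if_neg hpΩ]
  have : Fact (0 < 2 * π) := ⟨Real.two_pi_pos⟩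
  have hKc : IsCompact (K ×ˢ (univ : Set S1)) := hK.prod isCompact_univ
  have hz' : ∀ p ∉ K ×ˢ (univ : Set S1), φ' p = 0 := fun p hp =>
    hz p fun h => hp ⟨h, mem_univ _⟩
  refine ⟨φ', ψ + Ω.indicator (gradient g), ⟨?_, HasCompactSupport.intro hKc hz',
    (tsupport_subset_of_forall hKc.isClosed hz').trans
      (prod_mono hKΩ subset_rfl)⟩, hψ.add hVc, ?_, ?_⟩
  · rw [contDiff_iff_contDiffAt]
    rintro ⟨x, t⟩
    by_cases hx : x ∈ Ω
    · have h1 : ContDiffAt ℝ 1 (fun q : Plane × ℝ => unroll φ q - g q.1) (x, t) :=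
        (hcd x hx t).sub (ContDiffAt.comp (g := g) (x, t) (hg.contDiffAt (hΩ.mem_nhds hx)) contDiffAt_fst)
      refine h1.congr_of_eventuallyEq ?_
      filter_upwards [(hΩ.prod isOpen_univ).mem_nhds (⟨hx, mem_univ t⟩ : (x, t) ∈ Ω ×ˢ univ)]
        with q hq
      simp only [unroll, hφ', if_pos hq.1]
    · refine (contDiffAt_const (c := (0 : ℝ))).congr_of_eventuallyEq ?_
      have hxK : x ∉ K := fun h => hx (hKΩ h)
      filter_upwards [(hK.isClosed.isOpen_compl.prod isOpen_univ).mem_nhds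
        (⟨hxK, mem_univ t⟩ : (x, t) ∈ Kᶜ ×ˢ univ)] with q hq
      exact hz _ hq.1
  · rw [dualConstraint_iff] at hc ⊢
    intro x hx θ
    have h1 : gradX φ' (x, θ) = gradX φ (x, θ) - gradient g x := by
      obtain ⟨t, rfl⟩ := QuotientAddGroup.mk_surjective θ
      have he : (fun y => φ' (y, (t : S1))) =ᶠ[𝓝 x] fun y => φ (y, (t : S1)) - g y := by
        filter_upwards [hΩ.mem_nhds hx] with y hy
        simp only [hφ', if_pos hy]
      have hd1 : DifferentiableAt ℝ (fun y => φ (y, (t : S1))) x :=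
        DifferentiableAt.comp x (g := unroll φ) (f := fun y : Plane => (y, t)) (hda x hx t)
          (by fun_prop)
      have hd2 : DifferentiableAt ℝ g x :=
        (hg.contDiffAt (hΩ.mem_nhds hx)).differentiableAt one_ne_zero
      change gradient (fun y => φ' (y, (t : S1))) x = gradient (fun y => φ (y, (t : S1))) x - _
      unfold gradient
      rw [he.fderiv_eq, fderiv_fun_sub hd1 hd2, map_sub]
    have h2 : dTheta φ' (x, θ) = dTheta φ (x, θ) := by
      simp only [dTheta, hφ', if_pos hx, deriv_sub_const]
    have h3 : gradX φ' (x, θ) + (ψ + Ω.indicator (gradient g)) x = gradX φ (x, θ) + ψ x := by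
      rw [h1, Pi.add_apply, indicator_of_mem hx]; abel
    rw [h2, h3]
    exact hc x hx θ
  · rw [pairing_add _ (integrable_of_bounded hψ.continuous.stronglyMeasurable hψ.exists_bound)
      (integrable_of_bounded hVc.continuous.stronglyMeasurable hVc.exists_bound), hV0, add_zero]

theorem dualSup_eq (hΩ : IsOpen Ω) (hDu : IsBVDerivative Ω u Du) :
    dualSup Ω f Du (IsC1RTGradCc Ω) = dualSup Ω f Du (IsCc1RT Ω) := by
  refine le_antisymm (iSup₂_le fun ψ ⟨hψ, φ, hφ, hc⟩ => ?_)
    (iSup₂_le fun ψ ⟨hψ, φ, hφ, hc⟩ => ?_)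
  · obtain ⟨φ', ψ', hφ', hψ', hc', he⟩ := hφ.exists_isCc1RT hΩ hDu hψ hc
    rw [← he]
    exact le_iSup₂_of_le ψ' ⟨hψ', φ', hφ', hc'⟩ le_rfl
  · exact le_iSup₂_of_le ψ ⟨hψ, φ, hφ.isC1RTGradCc, hc⟩ le_rfl

end Reduction

/-! ### Admissible directions and suprema of integrands -/

/-- The unit vector `(cos α (cos θ, sin θ), sin α)`. -/
def admissibleDir (z : RTSpace × S1) : Vec3 :=
  WithLp.toLp 2 (Real.Angle.cos z.2 • dir z.1.2, Real.Angle.sin z.2)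

theorem continuous_dir : Continuous dir := by
  refine (PiLp.continuous_toLp 2 _).comp (continuous_pi fun i => ?_)
  fin_cases i
  · exact Real.Angle.continuous_cos
  · exact Real.Angle.continuous_sin

theorem continuous_cos_snd : Continuous fun z : RTSpace × S1 => Real.Angle.cos z.2 :=
  Real.Angle.continuous_cos.comp continuous_snd

theorem continuous_sin_snd : Continuous fun z : RTSpace × S1 => Real.Angle.sin z.2 :=
  Real.Angle.continuous_sin.comp continuous_snd

theorem continuous_admissibleDir : Continuous admissibleDir :=
  (WithLp.prod_continuous_toLp 2 Plane ℝ).comp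
    ((continuous_cos_snd.smul
      (continuous_dir.comp (continuous_snd.comp continuous_fst))).prodMk continuous_sin_snd)

theorem norm_admissibleDir (z : RTSpace × S1) : ‖admissibleDir z‖ = 1 := by
  have := Real.Angle.cos_sq_add_sin_sq z.2
  rw [WithLp.prod_norm_eq_of_L2]
  simp [admissibleDir, norm_smul, norm_dir, this]

theorem inner_admissibleDir (η : Vec3) (z : RTSpace × S1) :
    inner ℝ η (admissibleDir z) =
      inner ℝ (dir z.1.2) η.fst * Real.Angle.cos z.2 + η.snd * Real.Angle.sin z.2 := by
  simp only [WithLp.prod_inner_apply, admissibleDir, inner_smul_right, WithLp.ofLp_fst,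
    RCLike.inner_apply, conj_trivial, WithLp.ofLp_snd]
  rw [real_inner_comm]
  ring

theorem eq_smul_dir {θ : S1} {y : Plane} (h : inner ℝ (perp (dir θ)) y = 0) :
    y = inner ℝ (dir θ) y • dir θ := by
  have h1 := Real.Angle.cos_sq_add_sin_sq θ
  simp only [PiLp.inner_apply, Fin.sum_univ_two, perp, dir, LinearMap.coe_toContinuousLinearMap',
    LinearMap.coe_mk, AddHom.coe_mk, RCLike.inner_apply, conj_trivial, Matrix.cons_val_zero,
    Matrix.cons_val_one] at h ⊢
  ext i
  fin_cases i
  · simp only [Fin.zero_eta, PiLp.smul_apply, smul_eq_mul, Matrix.cons_val_zero]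
    linear_combination (-(y 0)) * h1 + Real.Angle.sin θ * h
  · simp only [Fin.mk_one, PiLp.smul_apply, smul_eq_mul, Matrix.cons_val_one, Matrix.cons_val_fin_one]
    linear_combination (-(y 1)) * h1 - Real.Angle.cos θ * h

theorem measurable_persp_angle (f : ℝ → ℝ≥0∞) :
    Measurable fun z : RTSpace × S1 => persp f (Real.Angle.cos z.2) (Real.Angle.sin z.2) :=
  (measurable_persp f).comp (continuous_cos_snd.measurable.prodMk continuous_sin_snd.measurable)

/-- Split `B` according to which of the two functions is larger; the bound on all measurable sets,
not only on the whole space, makes this work. -/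
theorem setLIntegral_sup_le {X : Type*} [MeasurableSpace X] {μ m : Measure X} {F G : X → ℝ≥0∞}
    (hF : Measurable F) (hG : Measurable G)
    (h1 : ∀ B, MeasurableSet B → ∫⁻ x in B, F x ∂μ ≤ m B)
    (h2 : ∀ B, MeasurableSet B → ∫⁻ x in B, G x ∂μ ≤ m B) {B : Set X} (hB : MeasurableSet B) :
    ∫⁻ x in B, (F ⊔ G) x ∂μ ≤ m B := by
  have hS : MeasurableSet {x | F x ≤ G x} := measurableSet_le hF hG
  rw [← lintegral_inter_add_sdiff _ B hS, ← measure_inter_add_sdiff B hS]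
  refine add_le_add ?_ ?_
  · refine (setLIntegral_congr_fun (hB.inter hS) fun x hx => ?_).trans_le (h2 _ (hB.inter hS))
    exact sup_eq_right.2 hx.2
  · refine (setLIntegral_congr_fun (hB.diff hS) fun x hx => ?_).trans_le (h1 _ (hB.diff hS))
    exact sup_eq_left.2 (not_le.1 hx.2).le

/-- If every function of a sequence has integrals controlled by a measure `m` on all sets, then so has
the supremum. -/
theorem lintegral_iSup_le {X : Type*} [MeasurableSpace X] {μ m : Measure X} {G : ℕ → X → ℝ≥0∞}
    (hG : ∀ n, Measurable (G n)) (h : ∀ n B, MeasurableSet B → ∫⁻ x in B, G n x ∂μ ≤ m B) :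
    ∫⁻ x, ⨆ n, G n x ∂μ ≤ m univ := by
  have key : ∀ n, Measurable (partialSups G n) ∧
      ∀ B, MeasurableSet B → ∫⁻ x in B, partialSups G n x ∂μ ≤ m B := by
    intro n
    induction n with
    | zero => simpa using ⟨hG 0, h 0⟩
    | succ n ih =>
      have hs : partialSups G (n + 1) = partialSups G n ⊔ G (n + 1) := partialSups_add_one G n
      rw [hs]
      exact ⟨ih.1.sup (hG _), fun B hB => setLIntegral_sup_le ih.1 (hG _) ih.2 (h _) hB⟩
  have he : ∀ x, ⨆ n, G n x = ⨆ n, partialSups G n x := fun x => by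
    have := congrFun (iSup_partialSups_eq G) x
    rw [iSup_apply, iSup_apply] at this
    exact this.symm
  simp_rw [he]
  rw [lintegral_iSup (fun n => (key n).1) (partialSups G).monotone]
  refine iSup_le fun n => ?_
  simpa using (key n).2 univ MeasurableSet.univ

/-! ### Jensen inequality for the projection of a measure on directions -/

section Energy

variable {f : ℝ → ℝ≥0∞} {σ : VectorMeasure RTSpace Vec3} [IsFiniteMeasure σ.variation]
  {ν : Measure (RTSpace × S1)} [IsFiniteMeasure ν]

theorem integrable_admissibleDir (ν : Measure (RTSpace × S1)) [IsFiniteMeasure ν] :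
    Integrable admissibleDir ν :=
  integrable_of_bounded continuous_admissibleDir.stronglyMeasurable
    ⟨1, fun z => (norm_admissibleDir z).le⟩

/-- Both sides are the pairing of `σ` with the field `η` restricted to `B`. -/
theorem setIntegral_inner_density
    (hσ : ∀ B, MeasurableSet B → σ B = ∫ z in Prod.fst ⁻¹' B, admissibleDir z ∂ν)
    {η : RTSpace → Vec3} (hη : StronglyMeasurable η) (hC : ∃ C, ∀ p, ‖η p‖ ≤ C)
    {B : Set RTSpace} (hB : MeasurableSet B) :
    ∫ p in B, inner ℝ (η p) (density σ p) ∂σ.variation =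
      ∫ z in Prod.fst ⁻¹' B, inner ℝ (η z.1) (admissibleDir z) ∂ν := by
  have hb : ∃ C, ∀ p, ‖B.indicator η p‖ ≤ C := by
    obtain ⟨C, hC⟩ := hC
    exact ⟨C, fun p => (norm_indicator_le_norm_self _ _).trans (hC p)⟩
  have h1 := pairing_eq_integral_density σ (hη.indicator hB) hb
  have h2 := pairing_eq_integral σ ν measurable_fst (integrable_admissibleDir ν) hσ
    (hη.indicator hB) hb
  rw [h1] at h2
  rw [← integral_indicator hB, ← integral_indicator (measurable_fst hB)]
  convert h2 using 2
  · funext p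
    by_cases hp : p ∈ B <;> simp [hp]
  · funext z
    by_cases hz : z.1 ∈ B <;> simp [indicator, hz]

omit [IsFiniteMeasure σ.variation] in
theorem integrable_inner_density {η : RTSpace → Vec3} (hη : StronglyMeasurable η)
    (hC : ∃ C, ∀ p, ‖η p‖ ≤ C) :
    Integrable (fun p => (inner ℝ (η p) (density σ p) : ℝ)) σ.variation := by
  obtain ⟨C, hC⟩ := hC
  refine ((integrable_density σ).norm.const_mul C).mono'
    (hη.aestronglyMeasurable.inner (integrable_density σ).aestronglyMeasurable)
    (Eventually.of_forall fun p => ?_)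
  exact (norm_inner_le_norm _ _).trans (mul_le_mul_of_nonneg_right (hC p) (norm_nonneg _))

/-- The field `(a (cos θ, sin θ), b)`. -/
def dirField (q : ℝ × ℝ) (p : RTSpace) : Vec3 := WithLp.toLp 2 (q.1 • dir p.2, q.2)

theorem continuous_dirField (q : ℝ × ℝ) : Continuous (dirField q) :=
  (WithLp.prod_continuous_toLp 2 Plane ℝ).comp
    (((continuous_dir.comp continuous_snd).const_smul q.1).prodMk continuous_const)

theorem exists_bound_dirField (q : ℝ × ℝ) : ∃ C, ∀ p, ‖dirField q p‖ ≤ C :=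
  ⟨√(q.1 ^ 2 + q.2 ^ 2), fun p => by
    rw [WithLp.prod_norm_eq_of_L2]
    simp [dirField, norm_smul, norm_dir]⟩

theorem inner_dirField_admissibleDir (q : ℝ × ℝ) (z : RTSpace × S1) :
    inner ℝ (dirField q z.1) (admissibleDir z) =
      q.1 * Real.Angle.cos z.2 + q.2 * Real.Angle.sin z.2 := by
  rw [inner_admissibleDir]
  simp [dirField, inner_smul_right, norm_dir]

theorem inner_dirField (q : ℝ × ℝ) (p : RTSpace) (w : Vec3) :
    inner ℝ (dirField q p) w = q.1 * inner ℝ (dir p.2) w.fst + q.2 * w.snd := by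
  simp [dirField, WithLp.prod_inner_apply, inner_smul_left, mul_comm]

/-- Averaging over `α` at fixed `(x, θ)` keeps the planar part in the ray spanned by `(cos θ, sin
θ)`, so `h` avoids its infinite branch. Testing with `dirField (1, 0)` gives the sign, and testing
with the rotated direction shows that the transversal component vanishes. -/
theorem density_fst_ae
    (hσ : ∀ B, MeasurableSet B → σ B = ∫ z in Prod.fst ⁻¹' B, admissibleDir z ∂ν)
    (hν : ∀ᵐ z ∂ν, 0 ≤ Real.Angle.cos z.2) :
    ∀ᵐ p ∂σ.variation, 0 ≤ (inner ℝ (dir p.2) (density σ p).fst : ℝ) ∧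
      (density σ p).fst = (inner ℝ (dir p.2) (density σ p).fst : ℝ) • dir p.2 := by
  have hη := (continuous_dirField (1, 0)).stronglyMeasurable
  have hηb := exists_bound_dirField (1, 0)
  have h1 : 0 ≤ᵐ[σ.variation] fun p => (inner ℝ (dirField (1, 0) p) (density σ p) : ℝ) := by
    refine ae_nonneg_of_forall_setIntegral_nonneg (integrable_inner_density hη hηb) fun B hB _ => ?_
    rw [setIntegral_inner_density hσ hη hηb hB]
    refine integral_nonneg_of_ae (ae_restrict_of_ae ?_)
    filter_upwards [hν] with z hz
    rw [inner_dirField_admissibleDir]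
    simpa using hz
  set ζ : RTSpace → Vec3 := fun p => WithLp.toLp 2 (perp (dir p.2), (0 : ℝ)) with hζdef
  have hζ : StronglyMeasurable ζ := Continuous.stronglyMeasurable <|
    (WithLp.prod_continuous_toLp 2 Plane ℝ).comp
      ((perp.continuous.comp (continuous_dir.comp continuous_snd)).prodMk continuous_const)
  have hζb : ∃ C, ∀ p, ‖ζ p‖ ≤ C := ⟨1, fun p => by simp [hζdef, norm_perp, norm_dir]⟩
  have h2 : (fun p => (inner ℝ (ζ p) (density σ p) : ℝ)) =ᵐ[σ.variation] 0 := by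
    refine (integrable_inner_density hζ hζb).ae_eq_zero_of_forall_setIntegral_eq_zero fun B hB _ => ?_
    rw [setIntegral_inner_density hσ hζ hζb hB]
    refine integral_eq_zero_of_ae (Eventually.of_forall fun z => ?_)
    simp only [Pi.zero_apply]
    rw [inner_admissibleDir]
    have h3 : inner ℝ (dir z.1.2) (perp (dir z.1.2)) = 0 := by
      have := inner_perp (dir z.1.2) (dir z.1.2)
      rw [real_inner_comm (dir z.1.2)] at this
      linarith
    simp [hζdef, h3]
  filter_upwards [h1, h2] with p hp1 hp2
  refine ⟨?_, eq_smul_dir ?_⟩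
  · rw [inner_dirField] at hp1
    simpa using hp1
  · simpa [hζdef, WithLp.prod_inner_apply] using hp2

/-- This is Jensen's inequality for one linear piece of the perspective. Restricting to the set
where the integrand is nonnegative turns its positive part into a signed integral, which can be
transferred to `ν`. -/
theorem setLIntegral_minorant_le
    (hσ : ∀ B, MeasurableSet B → σ B = ∫ z in Prod.fst ⁻¹' B, admissibleDir z ∂ν)
    (q : minorants f) {B : Set RTSpace} (hB : MeasurableSet B) :
    ∫⁻ p in B, ENNReal.ofReal (inner ℝ (dirField q.1 p) (density σ p)) ∂σ.variation ≤
      ∫⁻ z in Prod.fst ⁻¹' B, persp f (Real.Angle.cos z.2) (Real.Angle.sin z.2) ∂ν := by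
  have hη := (continuous_dirField q.1).stronglyMeasurable
  have hηb := exists_bound_dirField q.1
  have hint := integrable_inner_density (σ := σ) hη hηb
  set g : RTSpace → ℝ := fun p => inner ℝ (dirField q.1 p) (density σ p) with hg
  have hgm : Measurable g := (hη.measurable).inner (measurable_density σ)
  have hP : MeasurableSet {p | 0 ≤ g p} := measurableSet_le measurable_const hgm
  have h1 : ∫⁻ p in B, ENNReal.ofReal (g p) ∂σ.variation =
      ∫⁻ p in B ∩ {p | 0 ≤ g p}, ENNReal.ofReal (g p) ∂σ.variation := by
    rw [← lintegral_inter_add_sdiff _ B hP]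
    have : ∫⁻ p in B \ {p | 0 ≤ g p}, ENNReal.ofReal (g p) ∂σ.variation = 0 := by
      rw [← lintegral_zero (μ := σ.variation.restrict (B \ {p | 0 ≤ g p}))]
      exact setLIntegral_congr_fun (hB.diff hP) fun p hp =>
        ENNReal.ofReal_of_nonpos (not_le.1 hp.2).le
    rw [this, add_zero]
  rw [h1, ← ofReal_integral_eq_lintegral_ofReal hint.integrableOn
    ((ae_restrict_mem (hB.inter hP)).mono fun p hp => hp.2),
    setIntegral_inner_density hσ hη hηb (hB.inter hP)]
  refine (ofReal_integral_le_lintegral ?_).trans ?_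
  · refine (integrable_of_bounded (Continuous.stronglyMeasurable ?_) ?_).integrableOn
    · exact ((continuous_dirField q.1).comp continuous_fst).inner continuous_admissibleDir
    · obtain ⟨C, hC⟩ := hηb
      refine ⟨C, fun z => (norm_inner_le_norm _ _).trans ?_⟩
      rw [norm_admissibleDir, mul_one]
      exact hC _
  · refine (lintegral_mono fun z => ?_).trans
      (lintegral_mono_set (preimage_mono inter_subset_left))
    rw [inner_dirField_admissibleDir]
    exact le_iSup (fun q : minorants f => ENNReal.ofReal
      (q.1.1 * Real.Angle.cos z.2 + q.1.2 * Real.Angle.sin z.2)) q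

/-- The energy of the projection of a positive measure on the space of admissible directions. -/
theorem energy_le_lintegral_persp (hf : ConvexOn ℝ≥0 univ f) (hlsc : LowerSemicontinuous f)
    (hσ : ∀ B, MeasurableSet B → σ B = ∫ z in Prod.fst ⁻¹' B, admissibleDir z ∂ν) :
    energy f σ ≤ ∫⁻ z, persp f (Real.Angle.cos z.2) (Real.Angle.sin z.2) ∂ν := by
  set P : RTSpace × S1 → ℝ≥0∞ := fun z => persp f (Real.Angle.cos z.2) (Real.Angle.sin z.2)
  by_cases htop : ∫⁻ z, P z ∂ν = ∞
  · rw [htop]; exact le_top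
  have hPm : Measurable P := measurable_persp_angle f
  have hcos : ∀ᵐ z ∂ν, 0 ≤ Real.Angle.cos z.2 := by
    filter_upwards [ae_lt_top hPm htop] with z hz
    by_contra! hneg
    exact hz.ne (persp_eq_top_of_neg hneg _)
  obtain ⟨q, hq⟩ := exists_seq_persp f
  have hle : energy f σ ≤ ∫⁻ p, ⨆ n,
      ENNReal.ofReal (inner ℝ (dirField (q n).1 p) (density σ p)) ∂σ.variation := by
    refine lintegral_mono_ae ?_
    filter_upwards [density_fst_ae hσ hcos, density_ne_zero σ] with p hp hp0
    refine (h_le_persp hf hlsc p.2 hp0 hp.1 hp.2).trans (le_of_eq ?_)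
    rw [hq]
    simp_rw [inner_dirField]
  refine hle.trans ?_
  -- The projection of `persp · ν` is one measure dominating the integrals of all linear pieces, so
  -- it also controls their supremum.
  have hm : ∀ B, MeasurableSet B → ((ν.withDensity P).map Prod.fst) B =
      ∫⁻ z in Prod.fst ⁻¹' B, P z ∂ν := fun B hB => by
    rw [Measure.map_apply measurable_fst hB, withDensity_apply _ (measurable_fst hB)]
  refine (lintegral_iSup_le (m := (ν.withDensity P).map Prod.fst) (fun n => ?_)
    fun n B hB => ?_).trans (le_of_eq ?_)
  · exact ((continuous_dirField _).measurable.inner (measurable_density σ)).ennreal_ofReal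
  · rw [hm B hB]
    exact setLIntegral_minorant_le hσ (q n) hB
  · rw [hm _ MeasurableSet.univ, preimage_univ, setLIntegral_univ]

end Energy

open scoped CompactlySupported

/-! ### Gauge, Hahn-Banach extension and the Riesz measure -/

section HahnBanach

variable {f : ℝ → ℝ≥0∞} {γ : ℝ}

/-- The inverse of the closed perspective of `f` on the unit circle. -/
def weight (f : ℝ → ℝ≥0∞) (α : S1) : ℝ :=
  (persp f (Real.Angle.cos α) (Real.Angle.sin α))⁻¹.toReal

theorem weight_nonneg (α : S1) : 0 ≤ weight f α := ENNReal.toReal_nonneg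

theorem weight_le (hγ : 0 < γ) (hbelow : ∀ t : ℝ, ENNReal.ofReal (γ * √(1 + t ^ 2)) ≤ f t)
    (α : S1) : weight f α ≤ γ⁻¹ := by
  have h := le_persp_of_le hγ hbelow α
  unfold weight
  refine ENNReal.toReal_le_of_le_ofReal (inv_nonneg.2 hγ.le) ?_
  rw [ENNReal.ofReal_inv_of_pos hγ]
  exact ENNReal.inv_le_inv.2 h

theorem mul_weight_le_one {r : ℝ} {α : S1}
    (h : ENNReal.ofReal r ≤ persp f (Real.Angle.cos α) (Real.Angle.sin α)) :
    r * weight f α ≤ 1 := by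
  rcases le_or_gt r 0 with hr | hr
  · exact (mul_nonpos_of_nonpos_of_nonneg hr (weight_nonneg α)).trans zero_le_one
  have h1 : (ENNReal.ofReal r).toReal * weight f α ≤ (1 : ℝ≥0∞).toReal := by
    unfold weight
    rw [← ENNReal.toReal_mul]
    refine ENNReal.toReal_mono ENNReal.one_ne_top ?_
    rw [← div_eq_mul_inv]
    exact ENNReal.div_le_of_le_mul (by rwa [one_mul])
  rwa [ENNReal.toReal_ofReal hr.le, ENNReal.toReal_one] at h1

/-- The weight is `0` where the perspective is `∞`, correctly imposing no constraint. The positive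
lower bound rules out a zero perspective, for which `toReal` would also send the infinite inverse to
`0`. -/
theorem ofReal_le_persp_of_mul_weight_le (hγ : 0 < γ)
    (hbelow : ∀ t : ℝ, ENNReal.ofReal (γ * √(1 + t ^ 2)) ≤ f t) {r : ℝ} {α : S1}
    (h : r * weight f α ≤ 1) :
    ENNReal.ofReal r ≤ persp f (Real.Angle.cos α) (Real.Angle.sin α) := by
  have hpos := le_persp_of_le hγ hbelow α
  unfold weight at h
  set P := persp f (Real.Angle.cos α) (Real.Angle.sin α)
  by_cases htop : P = ∞
  · simp [htop]
  have h0 : 0 < P.toReal :=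
    ENNReal.toReal_pos ((ENNReal.ofReal_pos.2 hγ).trans_le hpos).ne' htop
  rw [ENNReal.toReal_inv, ← div_eq_mul_inv, div_le_one h0] at h
  exact ENNReal.ofReal_le_of_le_toReal h

/-- The gauge of the functions below the closed perspective. -/
def gaugeN (f : ℝ → ℝ≥0∞) (g : C_c(RTSpace × S1, ℝ)) : ℝ := ⨆ z, max 0 (g z * weight f z.2)

theorem bddAbove_gaugeN (hγ : 0 < γ) (hbelow : ∀ t : ℝ, ENNReal.ofReal (γ * √(1 + t ^ 2)) ≤ f t)
    (g : C_c(RTSpace × S1, ℝ)) : BddAbove (range fun z => max 0 (g z * weight f z.2)) := by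
  obtain ⟨C, hC⟩ := g.continuous.bounded_above_of_compact_support g.hasCompactSupport
  refine ⟨C * γ⁻¹, ?_⟩
  rintro _ ⟨z, rfl⟩
  have hC0 : 0 ≤ C := (norm_nonneg _).trans (hC z)
  refine max_le (mul_nonneg hC0 (inv_nonneg.2 hγ.le)) ?_
  exact mul_le_mul ((le_abs_self _).trans (hC z)) (weight_le hγ hbelow _) (weight_nonneg _) hC0

theorem gaugeN_nonneg (g : C_c(RTSpace × S1, ℝ)) : 0 ≤ gaugeN f g :=
  Real.iSup_nonneg fun _ => le_max_left _ _

theorem gaugeN_le {g : C_c(RTSpace × S1, ℝ)} {c : ℝ} (hc : 0 ≤ c)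
    (h : ∀ z, g z * weight f z.2 ≤ c) : gaugeN f g ≤ c :=
  Real.iSup_le (fun z => max_le hc (h z)) hc

theorem le_gaugeN (hγ : 0 < γ) (hbelow : ∀ t : ℝ, ENNReal.ofReal (γ * √(1 + t ^ 2)) ≤ f t)
    (g : C_c(RTSpace × S1, ℝ)) (z : RTSpace × S1) : g z * weight f z.2 ≤ gaugeN f g :=
  (le_max_right _ _).trans (le_ciSup (bddAbove_gaugeN hγ hbelow g) z)

theorem gaugeN_smul {c : ℝ} (hc : 0 < c) (g : C_c(RTSpace × S1, ℝ)) :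
    gaugeN f (c • g) = c * gaugeN f g := by
  unfold gaugeN
  rw [Real.mul_iSup_of_nonneg hc.le]
  refine iSup_congr fun z => ?_
  rw [mul_max_of_nonneg _ _ hc.le, mul_zero, CompactlySupportedContinuousMap.smul_apply,
    smul_eq_mul, mul_assoc]

theorem gaugeN_add (hγ : 0 < γ) (hbelow : ∀ t : ℝ, ENNReal.ofReal (γ * √(1 + t ^ 2)) ≤ f t)
    (g g' : C_c(RTSpace × S1, ℝ)) : gaugeN f (g + g') ≤ gaugeN f g + gaugeN f g' := by
  refine gaugeN_le (add_nonneg (gaugeN_nonneg g) (gaugeN_nonneg g')) fun z => ?_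
  rw [CompactlySupportedContinuousMap.add_apply, add_mul]
  exact add_le_add (le_gaugeN hγ hbelow g z) (le_gaugeN hγ hbelow g' z)

theorem exists_factor_range {W E : Type*} [AddCommGroup W] [Module ℝ W] [AddCommGroup E]
    [Module ℝ E] (T : W →ₗ[ℝ] E) (l : W →ₗ[ℝ] ℝ) (h : ∀ w, T w = 0 → l w = 0) :
    ∃ L : T.range →ₗ[ℝ] ℝ, ∀ w, L ⟨T w, T.mem_range_self w⟩ = l w := by
  have hk : T.ker ≤ l.ker := fun w hw => h w hw
  refine ⟨(T.ker.liftQ l hk).comp T.quotKerEquivRange.symm.toLinearMap, fun w => ?_⟩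
  rw [LinearMap.comp_apply, LinearEquiv.coe_coe, LinearMap.quotKerEquivRange_symm_apply_image]
  exact Submodule.liftQ_apply _ _ _

/-- A linear functional `l` on the parameters of a linear family `T` of test functions which is
controlled by the gauge is represented by a positive linear functional. -/
theorem exists_positive_extension (hγ : 0 < γ)
    (hbelow : ∀ t : ℝ, ENNReal.ofReal (γ * √(1 + t ^ 2)) ≤ f t) {W : Type*} [AddCommGroup W]
    [Module ℝ W] (T : W →ₗ[ℝ] C_c(RTSpace × S1, ℝ)) (l : W →ₗ[ℝ] ℝ) {M : ℝ} (hM : 0 ≤ M)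
    (h : ∀ w, l w ≤ M * gaugeN f (T w)) :
    ∃ Λ : C_c(RTSpace × S1, ℝ) →ₚ[ℝ] ℝ, (∀ w, Λ (T w) = l w) ∧ ∀ g, Λ g ≤ M * gaugeN f g := by
  have hker : ∀ w, T w = 0 → l w = 0 := by
    have hle : ∀ w, T w = 0 → l w ≤ 0 := fun w hw => by
      refine (h w).trans (mul_nonpos_of_nonneg_of_nonpos hM (gaugeN_le le_rfl fun z => ?_))
      rw [hw]; simp
    intro w hw
    have := hle (-w) (by rw [map_neg, hw, neg_zero])
    rw [map_neg] at this
    linarith [hle w hw]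
  obtain ⟨L, hLT⟩ := exists_factor_range T l hker
  obtain ⟨Λ, hΛ, hΛle⟩ := exists_extension_of_le_sublinear
    (⟨T.range, L⟩ : C_c(RTSpace × S1, ℝ) →ₗ.[ℝ] ℝ) (fun g => M * gaugeN f g)
    (fun c hc g => by rw [gaugeN_smul hc]; ring)
    (fun g g' => by
      rw [← mul_add]; exact mul_le_mul_of_nonneg_left (gaugeN_add hγ hbelow g g') hM)
    (fun ⟨_, w, hw⟩ => by
      subst hw
      exact (hLT w).trans_le (h w))
  refine ⟨PositiveLinearMap.mk₀ Λ fun g hg => ?_, fun w => ?_, hΛle⟩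
  -- Nonpositive functions have zero gauge, so the domination of the extension by the gauge already
  -- contains positivity.
  · have h1 := hΛle (-g)
    have h2 : gaugeN f (-g) ≤ 0 := gaugeN_le le_rfl fun z => by
      rw [CompactlySupportedContinuousMap.neg_apply]
      exact mul_nonpos_of_nonpos_of_nonneg (neg_nonpos.2 (hg z)) (weight_nonneg _)
    rw [map_neg] at h1
    have h3 := mul_nonpos_of_nonneg_of_nonpos hM h2
    linarith
  · exact (hΛ ⟨T w, T.mem_range_self w⟩).trans (hLT w)

/-- The measure representing a positive functional controlled by the gauge has bounded energy. -/
theorem lintegral_persp_le (Λ : C_c(RTSpace × S1, ℝ) →ₚ[ℝ] ℝ) {M : ℝ} (hM : 0 ≤ M)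
    (hΛ : ∀ g, Λ g ≤ M * gaugeN f g) {K : Set (RTSpace × S1)} (hK : IsCompact K) :
    ∫⁻ z in K, persp f (Real.Angle.cos z.2) (Real.Angle.sin z.2) ∂(RealRMK.rieszMeasure Λ) ≤
      ENNReal.ofReal M := by
  obtain ⟨q, hq⟩ := exists_seq_persp f
  set k : ℕ → RTSpace × S1 → ℝ := fun n z =>
    max 0 ((q n).1.1 * Real.Angle.cos z.2 + (q n).1.2 * Real.Angle.sin z.2) with hk
  have hkc : ∀ n, Continuous (k n) := fun n => continuous_const.max
    ((continuous_const.mul continuous_cos_snd).add (continuous_const.mul continuous_sin_snd))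
  have hk0 : ∀ n z, 0 ≤ k n z := fun n z => le_max_left _ _
  have hofk : ∀ n z, ENNReal.ofReal (k n z) =
      ENNReal.ofReal ((q n).1.1 * Real.Angle.cos z.2 + (q n).1.2 * Real.Angle.sin z.2) :=
    fun n z => by simp [hk, ENNReal.ofReal_max]
  -- The perspective need not be continuous or finite; it is the increasing limit of these
  -- continuous finite maxima. Cut off near `K`, each one has gauge at most `1`, so the functional
  -- is at most `M` on it.
  have hec : ∀ n, Continuous (partialSups k n) := fun n => Continuous.partialSups fun i _ => hkc i
  have he0 : ∀ n z, 0 ≤ partialSups k n z := fun n z =>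
    (hk0 n z).trans (le_partialSups k n z)
  have hle : ∀ n z, ENNReal.ofReal (partialSups k n z) ≤
      persp f (Real.Angle.cos z.2) (Real.Angle.sin z.2) := by
    intro n z
    have hn : ∀ n, ENNReal.ofReal (k n z) ≤
        persp f (Real.Angle.cos z.2) (Real.Angle.sin z.2) := fun n => by
      rw [hofk, hq]
      exact le_iSup (fun n => ENNReal.ofReal
        ((q n).1.1 * Real.Angle.cos z.2 + (q n).1.2 * Real.Angle.sin z.2)) n
    induction n with
    | zero => simpa using hn 0
    | succ n ih =>
      rw [show partialSups k (n + 1) = partialSups k n ⊔ k (n + 1) from partialSups_add_one k n,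
        Pi.sup_apply, ENNReal.ofReal_max]
      exact max_le ih (hn _)
  have hsup : ∀ z : RTSpace × S1, persp f (Real.Angle.cos z.2) (Real.Angle.sin z.2) =
      ⨆ n, ENNReal.ofReal (partialSups k n z) := by
    intro z
    refine le_antisymm ?_ (iSup_le fun n => hle n z)
    rw [hq]
    refine iSup_mono fun n => ?_
    rw [← hofk]
    exact ENNReal.ofReal_le_ofReal (le_partialSups k n z)
  simp_rw [hsup]
  rw [lintegral_iSup (fun n => (hec n).measurable.ennreal_ofReal)
    fun m n hmn z => ENNReal.ofReal_le_ofReal ((partialSups k).monotone hmn z)]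
  refine iSup_le fun n => ?_
  obtain ⟨χ, hχ1, -, hχc, hχ⟩ := exists_continuous_one_zero_of_isCompact hK isClosed_empty
    (disjoint_empty K)
  set g : C_c(RTSpace × S1, ℝ) :=
    ⟨⟨fun z => χ z * partialSups k n z, χ.continuous.mul (hec n)⟩, hχc.mul_right⟩ with hg
  have hgz : ∀ z, g z = χ z * partialSups k n z := fun z => rfl
  have hg1 : gaugeN f g ≤ 1 := by
    refine gaugeN_le zero_le_one fun z => ?_
    rw [hgz, mul_assoc]
    exact mul_le_one₀ (hχ z).2 (mul_nonneg (he0 n z) (weight_nonneg _))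
      (mul_weight_le_one (hle n z))
  calc ∫⁻ z in K, ENNReal.ofReal (partialSups k n z) ∂(RealRMK.rieszMeasure Λ)
      ≤ ∫⁻ z in K, ENNReal.ofReal (g z) ∂(RealRMK.rieszMeasure Λ) := by
        refine setLIntegral_mono' hK.measurableSet fun z hz => ?_
        rw [hgz, hχ1 hz, Pi.one_apply, one_mul]
    _ ≤ ∫⁻ z, ENNReal.ofReal (g z) ∂(RealRMK.rieszMeasure Λ) := setLIntegral_le_lintegral _ _
    _ = ENNReal.ofReal (∫ z, g z ∂(RealRMK.rieszMeasure Λ)) := by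
        refine (ofReal_integral_eq_lintegral_ofReal
          (g.continuous.integrable_of_hasCompactSupport g.hasCompactSupport)
          (Eventually.of_forall fun z => ?_)).symm
        exact mul_nonneg (hχ z).1 (he0 n z)
    _ ≤ ENNReal.ofReal M := by
        rw [RealRMK.integral_rieszMeasure]
        refine ENNReal.ofReal_le_ofReal ((hΛ g).trans ?_)
        exact mul_le_of_le_one_right hM hg1

end HahnBanach

/-! ### Strong duality -/

section StrongDuality

variable {Ω : Set Plane} {u : Plane → ℝ} {Du : VectorMeasure Plane Plane} {f : ℝ → ℝ≥0∞} {γ : ℝ}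

/-- The space of pairs `(φ, ψ)` of test functions. -/
def testPairs (Ω : Set Plane) : Submodule ℝ ((RTSpace → ℝ) × (Plane → Plane)) where
  carrier := {w | IsCc1RT Ω w.1 ∧ IsCc Ω w.2}
  add_mem' h h' := ⟨h.1.add h'.1, h.2.add h'.2⟩
  zero_mem' := ⟨IsCc1RT.zero, IsCc.zero⟩
  smul_mem' c _ h := ⟨h.1.smul c, h.2.smul c⟩

/-- The field `(∇_x φ + ψ, ∂_θ φ)`. -/
def pairField (w : (RTSpace → ℝ) × (Plane → Plane)) (p : RTSpace) : Vec3 :=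
  grad w.1 p + liftField w.2 p

theorem continuous_pairField (w : testPairs Ω) : Continuous (pairField w.1) :=
  (continuous_grad w.2.1.contDiff).add (continuous_liftField w.2.2.continuous)

theorem pairField_add (w w' : testPairs Ω) (p : RTSpace) :
    pairField (w + w').1 p = pairField w.1 p + pairField w'.1 p := by
  have h := grad_add w.2.1.contDiff w'.2.1.contDiff p
  have h' : liftField (w.1.2 + w'.1.2) p = liftField w.1.2 p + liftField w'.1.2 p := by
    simp [liftField, ← WithLp.toLp_add]
  change grad (w.1.1 + w'.1.1) p + liftField (w.1.2 + w'.1.2) p = _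
  rw [h, h']
  unfold pairField
  abel

theorem pairField_smul (c : ℝ) (w : testPairs Ω) (p : RTSpace) :
    pairField (c • w).1 p = c • pairField w.1 p := by
  have h := grad_smul w.2.1.contDiff c p
  have h' : liftField (c • w.1.2) p = c • liftField w.1.2 p := by
    simp [liftField, ← WithLp.toLp_smul]
  change grad (c • w.1.1) p + liftField (c • w.1.2) p = _
  rw [h, h', ← smul_add]
  rfl

/-- A compact set outside which the field of a pair of test functions vanishes. -/
def pairSupport (w : (RTSpace → ℝ) × (Plane → Plane)) : Set RTSpace :=
  tsupport w.1 ∪ tsupport w.2 ×ˢ univ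

theorem isCompact_pairSupport (w : testPairs Ω) : IsCompact (pairSupport w.1) := by
  have : Fact (0 < 2 * π) := ⟨Real.two_pi_pos⟩
  have h1 : IsCompact (tsupport w.1.1) := w.2.1.hasCompactSupport
  have h2 : IsCompact (tsupport w.1.2) := w.2.2.hasCompactSupport
  exact h1.union (h2.prod isCompact_univ)

theorem pairSupport_subset (w : testPairs Ω) : pairSupport w.1 ⊆ lift Ω :=
  union_subset w.2.1.tsupport_subset (prod_mono w.2.2.tsupport_subset subset_rfl)

theorem pairField_eq_zero (w : (RTSpace → ℝ) × (Plane → Plane)) {p : RTSpace}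
    (hp : p ∉ pairSupport w) : pairField w p = 0 := by
  have h1 : p ∉ tsupport w.1 := fun h => hp (Or.inl h)
  have h2 : p.1 ∉ tsupport w.2 := fun h => hp (Or.inr ⟨h, mem_univ _⟩)
  rw [pairField, grad_eq_zero_of_notMem_tsupport h1, liftField, image_eq_zero_of_notMem_tsupport h2,
    zero_add]
  rfl

theorem exists_bound_pairField (w : testPairs Ω) : ∃ C, ∀ p, ‖pairField w.1 p‖ ≤ C :=
  (continuous_pairField w).bounded_above_of_compact_support
    (HasCompactSupport.intro (isCompact_pairSupport w) fun _ => pairField_eq_zero w.1)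

/-- The test function on the space of admissible directions given by a pair of test functions. -/
def pairTest (w : testPairs Ω) : C_c(RTSpace × S1, ℝ) where
  toFun z := inner ℝ (pairField w.1 z.1) (admissibleDir z)
  continuous_toFun := ((continuous_pairField w).comp continuous_fst).inner continuous_admissibleDir
  hasCompactSupport' := by
    have : Fact (0 < 2 * π) := ⟨Real.two_pi_pos⟩
    refine HasCompactSupport.intro ((isCompact_pairSupport w).prod isCompact_univ) fun z hz => ?_
    rw [pairField_eq_zero w.1 fun h => hz ⟨h, mem_univ _⟩, inner_zero_left]

theorem pairTest_apply (w : testPairs Ω) (z : RTSpace × S1) :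
    pairTest w z = inner ℝ (pairField w.1 z.1) (admissibleDir z) := rfl

/-- `pairTest` as a linear map. -/
def pairTestLinear (Ω : Set Plane) : testPairs Ω →ₗ[ℝ] C_c(RTSpace × S1, ℝ) where
  toFun := pairTest
  map_add' w w' := by
    ext z
    rw [CompactlySupportedContinuousMap.add_apply, pairTest_apply, pairTest_apply, pairTest_apply,
      pairField_add, inner_add_left]
  map_smul' c w := by
    ext z
    rw [RingHom.id_apply, CompactlySupportedContinuousMap.smul_apply, pairTest_apply,
      pairTest_apply, pairField_smul, inner_smul_left]
    rfl

/-- The functional `(φ, ψ) ↦ ∫ ψ · Du^⊥`. -/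
def pairFunctional (Ω : Set Plane) (Du : VectorMeasure Plane Plane)
    [IsFiniteMeasure Du.variation] : testPairs Ω →ₗ[ℝ] ℝ where
  toFun w := pairing w.1.2 (perpMeasure Du)
  map_add' w w' := pairing_add _
    (integrable_of_bounded w.2.2.continuous.stronglyMeasurable w.2.2.exists_bound)
    (integrable_of_bounded w'.2.2.continuous.stronglyMeasurable w'.2.2.exists_bound)
  map_smul' c _ := pairing_smul _ c _

theorem dualConstraint_of_forall_le_persp {w : testPairs Ω}
    (h : ∀ z, ENNReal.ofReal (pairTest w z) ≤
      persp f (Real.Angle.cos z.2) (Real.Angle.sin z.2)) : DualConstraint Ω f w.1.2 w.1.1 := by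
  rw [dualConstraint_iff]
  intro x _ θ
  refine mem_minorants_of_forall_le_persp fun α => ?_
  have h1 := h ((x, θ), α)
  rw [pairTest_apply, inner_admissibleDir] at h1
  have h2 : (pairField w.1 (x, θ)).fst = gradX w.1.1 (x, θ) + w.1.2 x := rfl
  have h3 : (pairField w.1 (x, θ)).snd = dTheta w.1.1 (x, θ) := by
    simp [pairField, grad, liftField]
  rw [h2, h3] at h1
  exact h1

/-- Dividing a pair by any `r` above its gauge makes it feasible for the dual problem, which gives
the bound with `r`. Letting `r` decrease to the gauge covers also the case of gauge zero. -/
theorem pairFunctional_le (hγ : 0 < γ)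
    (hbelow : ∀ t : ℝ, ENNReal.ofReal (γ * √(1 + t ^ 2)) ≤ f t) [IsFiniteMeasure Du.variation]
    {M : ℝ} (h : ∀ w : testPairs Ω, DualConstraint Ω f w.1.2 w.1.1 →
      pairFunctional Ω Du w ≤ M) (w : testPairs Ω) :
    pairFunctional Ω Du w ≤ M * gaugeN f (pairTestLinear Ω w) := by
  have key : ∀ r, gaugeN f (pairTest w) < r → pairFunctional Ω Du w ≤ M * r := by
    intro r hr
    have hr0 : 0 < r := (gaugeN_nonneg _).trans_lt hr
    have h1 := h (r⁻¹ • w) (dualConstraint_of_forall_le_persp fun z => by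
      refine ofReal_le_persp_of_mul_weight_le hγ hbelow ?_
      have h2 : pairTest (r⁻¹ • w) z = r⁻¹ * pairTest w z := by
        rw [pairTest_apply, pairTest_apply, pairField_smul, inner_smul_left]; rfl
      rw [h2, mul_assoc, inv_mul_le_iff₀ hr0, mul_one]
      exact (le_gaugeN hγ hbelow _ z).trans hr.le)
    rw [map_smul, smul_eq_mul, inv_mul_le_iff₀ hr0] at h1
    linarith
  have hlim : Tendsto (fun r : ℝ => M * r) (𝓝[>] gaugeN f (pairTest w))
      (𝓝 (M * gaugeN f (pairTest w))) :=
    ((continuous_const.mul continuous_id).tendsto _).mono_left nhdsWithin_le_nhds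
  exact ge_of_tendsto hlim (eventually_mem_nhdsWithin.mono fun r hr => key r hr)

/-- The vector measure on the roto-translation space obtained from a measure on the space of
admissible directions. -/
def projMeasure (ν : Measure (RTSpace × S1)) : VectorMeasure RTSpace Vec3 :=
  (ν.withDensityᵥ admissibleDir).map Prod.fst

theorem projMeasure_apply (ν : Measure (RTSpace × S1)) [IsFiniteMeasure ν] {B : Set RTSpace}
    (hB : MeasurableSet B) : projMeasure ν B = ∫ z in Prod.fst ⁻¹' B, admissibleDir z ∂ν := by
  rw [projMeasure, VectorMeasure.map_apply _ measurable_fst hB,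
    withDensityᵥ_apply (integrable_admissibleDir ν) (measurable_fst hB)]

theorem variation_projMeasure_le (ν : Measure (RTSpace × S1)) [IsFiniteMeasure ν] :
    (projMeasure ν).variation ≤ ν.map Prod.fst := by
  refine VectorMeasure.variation_le_of_forall_enorm_le fun B hB => ?_
  rw [projMeasure_apply ν hB, Measure.map_apply measurable_fst hB]
  refine (enorm_integral_le_lintegral_enorm _).trans (le_of_eq ?_)
  have : ∀ z, ‖admissibleDir z‖ₑ = 1 := fun z => by
    rw [← ofReal_norm, norm_admissibleDir, ENNReal.ofReal_one]
  simp_rw [this]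
  rw [setLIntegral_one]

/-- Representing the functional on pairs encodes both linear constraints: pairs `(φ, 0)` give zero
divergence, and pairs `(0, φ^⊥)` give the marginal. -/
theorem admissible_projMeasure (hΩ : IsOpen Ω) (hDu : IsBVDerivative Ω u Du)
    [IsFiniteMeasure Du.variation] (ν : Measure (RTSpace × S1)) [IsFiniteMeasure ν]
    (hν : ν (Prod.fst ⁻¹' lift Ω)ᶜ = 0)
    (h : ∀ w : testPairs Ω, ∫ z, pairTest w z ∂ν = pairFunctional Ω Du w) :
    Admissible Ω u (projMeasure ν) := by
  have hfin : IsFiniteMeasure (projMeasure ν).variation :=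
    isFiniteMeasure_of_le _ (variation_projMeasure_le ν)
  have hpair : ∀ w : testPairs Ω,
      pairing (pairField w.1) (projMeasure ν) = pairing w.1.2 (perpMeasure Du) := fun w => by
    rw [pairing_eq_integral (projMeasure ν) ν measurable_fst (integrable_admissibleDir ν)
      (fun B hB => projMeasure_apply ν hB) (continuous_pairField w).stronglyMeasurable
      (exists_bound_pairField w)]
    exact h w
  refine ⟨hfin, ?_, fun φ hφ => ?_, fun φ hφ => ?_⟩
  · refine le_antisymm ((variation_projMeasure_le ν _).trans ?_) zero_le
    have hm : MeasurableSet (lift Ω)ᶜ := (hΩ.measurableSet.prod MeasurableSet.univ).compl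
    rw [Measure.map_apply measurable_fst hm]
    exact hν.le
  · have h1 := hpair ⟨(φ, 0), hφ, IsCc.zero⟩
    have h2 : pairField (φ, 0) = grad φ := by
      funext p
      have : liftField 0 p = 0 := rfl
      rw [pairField, this, add_zero]
    have h3 : pairing (0 : Plane → Plane) (perpMeasure Du) = 0 :=
      VectorMeasure.integral_zero
    rw [h2] at h1
    exact h1.trans h3
  · have h1 := hpair ⟨(0, fun x => perp (φ x)), IsCc1RT.zero, hφ.isCc.perp⟩
    have h2 : pairField (0, fun x => perp (φ x)) =
        fun p : RTSpace => (WithLp.toLp 2 (perp (φ p.1), (0 : ℝ)) : Vec3) := by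
      funext p
      have : grad 0 p = 0 := grad_zero p
      rw [pairField, this, zero_add]
      rfl
    rw [h2] at h1
    refine h1.trans ?_
    rw [pairing_perpMeasure Du hφ.isCc.perp.continuous.stronglyMeasurable hφ.isCc.perp.exists_bound,
      ← hDu.integral_eq φ hφ]
    simp [perp_perp]

/-- Absence of a duality gap, for a finite value of the dual problem. -/
theorem F_le_of_forall_le (hΩ : IsOpen Ω) (hΩb : Bornology.IsBounded Ω)
    (hf : ConvexOn ℝ≥0 univ f) (hlsc : LowerSemicontinuous f) (hγ : 0 < γ)
    (hbelow : ∀ t : ℝ, ENNReal.ofReal (γ * √(1 + t ^ 2)) ≤ f t) (hDu : IsBVDerivative Ω u Du)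
    {M : ℝ} (hM : 0 ≤ M)
    (h : ∀ ψ φ, IsCc Ω ψ → IsCc1RT Ω φ → DualConstraint Ω f ψ φ →
      pairing ψ (perpMeasure Du) ≤ M) : F Ω f u ≤ ENNReal.ofReal M := by
  have : Fact (0 < 2 * π) := ⟨Real.two_pi_pos⟩
  have := hDu.finite
  obtain ⟨Λ, hΛT, hΛ⟩ := exists_positive_extension hγ hbelow (pairTestLinear Ω)
    (pairFunctional Ω Du) hM
    (pairFunctional_le hγ hbelow fun w hw => h w.1.2 w.1.1 w.2.2 w.2.1 hw)
  set K : Set (RTSpace × S1) := (closure Ω ×ˢ univ) ×ˢ univ with hKdef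
  have hK : IsCompact K := (hΩb.isCompact_closure.prod isCompact_univ).prod isCompact_univ
  set D : Set (RTSpace × S1) := Prod.fst ⁻¹' lift Ω with hD
  have hDm : MeasurableSet D := measurable_fst (hΩ.measurableSet.prod MeasurableSet.univ)
  have hDK : D ⊆ K := fun z hz => ⟨⟨subset_closure hz.1, mem_univ _⟩, mem_univ _⟩
  -- The Riesz measure lives over the whole plane. Restricting it over the bounded set `Ω` makes it
  -- finite and concentrated, and loses nothing against the test fields, which vanish elsewhere.
  set ν := (RealRMK.rieszMeasure Λ).restrict D with hν
  have hνfin : IsFiniteMeasure ν := by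
    refine ⟨?_⟩
    rw [hν, Measure.restrict_apply_univ]
    exact (measure_mono hDK).trans_lt hK.measure_lt_top
  have hadm : Admissible Ω u (projMeasure ν) := by
    refine admissible_projMeasure hΩ hDu ν ?_ fun w => ?_
    · rw [hν, Measure.restrict_apply hDm.compl]
      simp
    · rw [← hΛT w, ← RealRMK.integral_rieszMeasure Λ, hν]
      refine setIntegral_eq_integral_of_forall_compl_eq_zero fun z hz => ?_
      rw [pairTest_apply, pairField_eq_zero w.1 fun hz' => hz (pairSupport_subset w hz'),
        inner_zero_left]
  have := hadm.finite
  refine (iInf₂_le _ hadm).trans ((energy_le_lintegral_persp hf hlsc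
    fun B hB => projMeasure_apply ν hB).trans ?_)
  exact (lintegral_mono' (Measure.restrict_mono hDK le_rfl) le_rfl).trans
    (lintegral_persp_le Λ hM hΛ hK)

/-- The zero pair is feasible because `f ≥ 0`, so the dual value is either `∞`, where nothing is to
be shown, or a real `M ≥ 0`. -/
theorem F_le_dualSup (hΩ : IsOpen Ω) (hΩb : Bornology.IsBounded Ω)
    (hf : ConvexOn ℝ≥0 univ f) (hlsc : LowerSemicontinuous f) (hγ : 0 < γ)
    (hbelow : ∀ t : ℝ, ENNReal.ofReal (γ * √(1 + t ^ 2)) ≤ f t) (hDu : IsBVDerivative Ω u Du) :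
    ((F Ω f u : ℝ≥0∞) : EReal) ≤ dualSup Ω f Du (IsCc1RT Ω) := by
  have hle : ∀ ψ φ, IsCc Ω ψ → IsCc1RT Ω φ → DualConstraint Ω f ψ φ →
      ((pairing ψ (perpMeasure Du) : ℝ) : EReal) ≤ dualSup Ω f Du (IsCc1RT Ω) :=
    fun ψ φ hψ hφ hc => le_iSup₂_of_le ψ ⟨hψ, φ, hφ, hc⟩ le_rfl
  have h0 : (0 : EReal) ≤ dualSup Ω f Du (IsCc1RT Ω) := by
    have hz : pairing (0 : Plane → Plane) (perpMeasure Du) = 0 := VectorMeasure.integral_zero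
    have h1 := hle 0 0 IsCc.zero IsCc1RT.zero (by
      rw [dualConstraint_iff]
      intro x _ θ
      have h2 : grad 0 (x, θ) = 0 := grad_zero _
      have h3 : gradX 0 (x, θ) = 0 := congrArg WithLp.fst h2
      have h4 : dTheta 0 (x, θ) = 0 := congrArg WithLp.snd h2
      rw [h3, h4]
      simpa using zero_mem_minorants f)
    rwa [hz] at h1
  induction hS : dualSup Ω f Du (IsCc1RT Ω) with
  | bot => rw [hS] at h0; simp at h0
  | top => exact le_top
  | coe M =>
    rw [hS] at h0 hle
    have hM : 0 ≤ M := EReal.coe_nonneg.1 h0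
    have h1 := F_le_of_forall_le hΩ hΩb hf hlsc hγ hbelow hDu hM fun ψ φ hψ hφ hc =>
      EReal.coe_le_coe_iff.1 (hle ψ φ hψ hφ hc)
    refine (EReal.coe_ennreal_le_coe_ennreal_iff.2 h1).trans (le_of_eq ?_)
    rw [EReal.coe_ennreal_ofReal, max_eq_left hM]

end StrongDuality

end RotoTranslation

end

/-! ### The duality formula -/

theorem mainTheorem3
    (Ω : Set RotoTranslation.Plane) (hΩ_open : IsOpen Ω) (hΩ_bdd : Bornology.IsBounded Ω)
    (f : ℝ → ℝ≥0∞) (hf_convex : ConvexOn ℝ≥0 Set.univ f) (hf_lsc : LowerSemicontinuous f)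
    (γ : ℝ) (hγ : 0 < γ) (hf_below : ∀ t : ℝ, ENNReal.ofReal (γ * √(1 + t ^ 2)) ≤ f t)
    (u : RotoTranslation.Plane → ℝ) (hu : IntegrableOn u Ω volume)
    (Du : VectorMeasure RotoTranslation.Plane RotoTranslation.Plane)
    (hDu : RotoTranslation.IsBVDerivative Ω u Du) :
    (IsConnected (frontier Ω) →
      ((RotoTranslation.F Ω f u : ℝ≥0∞) : EReal)
        = RotoTranslation.dualSup Ω f Du (RotoTranslation.IsCc1RT Ω)) ∧
    (¬ IsConnected (frontier Ω) →
      ((RotoTranslation.F Ω f u : ℝ≥0∞) : EReal)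
        = RotoTranslation.dualSup Ω f Du (RotoTranslation.IsC1RTGradCc Ω)) := by
  have h := le_antisymm
    (RotoTranslation.F_le_dualSup hΩ_open hΩ_bdd hf_convex hf_lsc hγ hf_below hDu)
    (RotoTranslation.dualSup_le_F hDu)
  exact ⟨fun _ => h, fun _ => h.trans (RotoTranslation.dualSup_eq hΩ_open hDu).symm⟩
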